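/- \textbf{Setting.} Let $(K,d)$ be a metric space in which sets of finite diameter are relatively compact, and let $V$ and $E$ be the finite sets of vertices and edges of a directed multigraph, where the edge $e$ has initial vertex $i(e)$ and terminal vertex $t(e)$. Let $(K_v)_{v\in V}$ be a partition of $K$ into non-empty open sets. For each $e\in E$ let $w_e:K\to K$ be a Borel map with $w_e(K_{i(e)})\subset K_{t(e)}$, and let $p_e:K\to[0,\infty)$ be a Borel function that vanishes off $K_{i(e)}$, such that $\sum_{e\in E}p_e(x)=1$ for all $x\in K$. Assume that the system is contractive on average: there is $0<a<1$ with $\sum_{e\in E}p_e(x)\,d(w_ex,w_ey)\le a\,d(x,y)$ for all $v\in V$ and $x,y\in K_v$. Assume also that each $p_e|_{K_{i(e)}}$ is uniformly continuous and that there is $\delta>0$ with $p_e|_{K_{i(e)}}\ge\delta$ for all $e\in E$. Such a system is called a contractive Markov system (CMS). A Borel probability measure $\mu$ on $K$ is \emph{invariant} if $\int\sum_{e}p_e\cdot(f\circ w_e)\,d\mu=\int f\,d\mu$ for all bounded Borel functions $f:K\to\mathbb R$. Let $\Sigma=E^{\mathbb Z}$ with the product topology and its Borel $\sigma$-algebra,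 and let $S$ be the left shift on $\Sigma$, $(S\sigma)_n=\sigma_{n+1}$. The generalized Markov measure $M$ associated with an invariant measure $\mu$ is the Borel probability measure on $\Sigma$ with $$M(\{\sigma:\sigma_m=e_1,\dots,\sigma_{m+k-1}=e_k\})=\int p_{e_1}(x)\,p_{e_2}(w_{e_1}x)\cdots p_{e_k}(w_{e_{k-1}}\circ\cdots\circ w_{e_1}x)\,d\mu(x)$$ for all $m\in\mathbb Z$ and $e_1,\dots,e_k\in E$. Fix $x_v\in K_v$ for each $v\in V$. Let $D$ be the set of all $\sigma\in\Sigma$ with $t(\sigma_j)=i(\sigma_{j+1})$ for all $j\in\mathbb Z$ for which the limit $$F(\sigma)=\lim_{m\to-\infty}w_{\sigma_0}\circ w_{\sigma_{-1}}\circ\cdots\circ w_{\sigma_m}(x_{i(\sigma_m)})$$ exists in $K$, and let $Y=\bigcap_{j\in\mathbb Z}S^j(D)$. Define $u:\Sigma\to[-\infty,0]$ by $u(\sigma)=\log p_{\sigma_1}(F(\sigma))$ for $\sigma\in Y$ and $u(\sigma)=-\infty$ for $\sigma\notin Y$. For an $S$-invariant Borel probability measure $\Theta$ on $\Sigma$ let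 $h_\Theta(S)$ be the Kolmogorov--Sinai entropy of $S$ with respect to $\Theta$, and put $\Theta(u)=\int u\,d\Theta\in[-\infty,0]$. An \emph{equilibrium state} for $u$ is an $S$-invariant Borel probability measure $\Lambda$ on $\Sigma$ with $h_\Lambda(S)+\Lambda(u)=\sup_\Theta\bigl(h_\Theta(S)+\Theta(u)\bigr)$, where the supremum is over all $S$-invariant Borel probability measures $\Theta$ on $\Sigma$. \textbf{Theorem.} Suppose that the CMS has a unique invariant Borel probability measure $\mu$, and that $M(Y)=1$ for the associated generalized Markov measure $M$. Then $u$ is Borel measurable and the following hold. (i) $M$ is the unique equilibrium state for $u$. (ii) $F(M)=\mu$, i.e. $\mu$ is the image of $M$ under $F$ (which is defined $M$-almost everywhere). (iii) $h_M(S)=-\sum_{e\in E}\int_{K_{i(e)}}p_e\log p_e\,d\mu$. -/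

import Mathlib

open MeasureTheory Filter Topology
open scoped ENNReal

noncomputable section

/-! ## Entropy, pressure and equilibrium states -/

section Thermodynamics

variable {X : Type*} [MeasurableSpace X]

/-- The Shannon entropy `-∑ j, Θ(ξ = j) log Θ(ξ = j)` of the finite partition `{ξ = j}`. -/
def partitionEntropy {ι : Type*} [Fintype ι] (Θ : Measure X) (ξ : X → ι) : ℝ :=
  ∑ j, Real.negMulLog (Θ.real (ξ ⁻¹' {j}))

/-- The labelling map of the join of the partitions `ξ, T⁻¹ ξ, …, T⁻⁽ⁿ⁻¹⁾ ξ`. -/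
def itinerary {ι : Type*} (T : X → X) (ξ : X → ι) (n : ℕ) (x : X) : Fin n → ι :=
  fun j => ξ (T^[j] x)

/-- The Kolmogorov-Sinai entropy: the supremum over all finite measurable partitions `ξ` of the
limit of `H(ξ ∨ T⁻¹ ξ ∨ … ∨ T⁻⁽ⁿ⁻¹⁾ ξ) / n`. For an invariant probability measure this limit exists
by subadditivity, so that it is the upper limit. -/
def ksEntropy (Θ : Measure X) (T : X → X) : EReal :=
  ⨆ (k : ℕ) (ξ : X → Fin k) (_ : Measurable ξ),
    limsup (fun n : ℕ => ((partitionEntropy Θ (itinerary T ξ n) / n : ℝ) : EReal)) atTop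

/-- An energy function is a measurable function with values in `[-∞, 0]`. -/
def IsEnergyFunction (f : X → EReal) : Prop :=
  Measurable f ∧ ∀ x, f x ≤ 0

/-- The integral `Θ(f) ∈ [-∞, 0]` of an energy function `f`. -/
def energyIntegral (Θ : Measure X) (f : X → EReal) : EReal :=
  -((∫⁻ x, (-f x).toENNReal ∂Θ : ℝ≥0∞) : EReal)

/-- `Θ` is a `T`-invariant probability measure. -/
def IsInvariantProb (T : X → X) (Θ : Measure X) : Prop :=
  IsProbabilityMeasure Θ ∧ MeasurePreserving T Θ Θ

/-- The pressure of the energy function `f`, for a transformation `T` of finite topological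
entropy. -/
def pressure (T : X → X) (f : X → EReal) : EReal :=
  ⨆ (Θ : Measure X) (_ : IsInvariantProb T Θ), ksEntropy Θ T + energyIntegral Θ f

/-- `Λ` is an equilibrium state for the energy function `f`. -/
def IsEquilibriumState (T : X → X) (f : X → EReal) (Λ : Measure X) : Prop :=
  IsInvariantProb T Λ ∧ ksEntropy Λ T + energyIntegral Λ f = pressure T f

end Thermodynamics

/-! ## The code space -/

section CodeSpace

variable {E : Type*}

/-- The `j`-th power `S ^ j` of the left shift on the two-sided code space. For a finite discrete
alphabet `E`, the product `σ`-algebra on `ℤ → E` is the Borel `σ`-algebra of the product topology. -/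
def shiftBy (j : ℤ) (σ : ℤ → E) : ℤ → E := fun n => σ (n + j)

/-- The left shift `S`. -/
def leftShift : (ℤ → E) → (ℤ → E) := shiftBy 1

/-- The cylinder set of all `σ` with `σ m = e₁, …, σ (m + k - 1) = eₖ`. -/
def codeCylinder (m : ℤ) (l : List E) : Set (ℤ → E) :=
  {σ | ∀ (k : ℕ) (hk : k < l.length), σ (m + k) = l[k]}

end CodeSpace

/-! ## Markov systems -/

/-- A Markov system `(K_{i(e)}, w_e, p_e)_{e ∈ E}` on `K` with vertices `V` and edges `E`. -/
structure MarkovSystem (K V E : Type*) [MeasurableSpace K] [Fintype E] where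
  /-- the initial vertex `i(e)` of an edge -/
  init : E → V
  /-- the terminal vertex `t(e)` of an edge -/
  term : E → V
  /-- the vertex sets `K_i` -/
  vset : V → Set K
  vset_nonempty : ∀ i, (vset i).Nonempty
  vset_measurable : ∀ i, MeasurableSet (vset i)
  vset_disjoint : Pairwise fun i j => Disjoint (vset i) (vset j)
  vset_cover : ⋃ i, vset i = Set.univ
  /-- the maps `w_e` -/
  w : E → K → K
  w_measurable : ∀ e, Measurable (w e)
  w_mapsTo : ∀ e, Set.MapsTo (w e) (vset (init e)) (vset (term e))
  /-- the probability functions `p_e` -/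
  p : E → K → ℝ
  p_measurable : ∀ e, Measurable (p e)
  p_nonneg : ∀ e x, 0 ≤ p e x
  p_sum : ∀ x, ∑ e, p e x = 1
  p_zero : ∀ e x, x ∉ vset (init e) → p e x = 0

namespace MarkovSystem

variable {K V E : Type*} [MeasurableSpace K] [Fintype E] (𝓜 : MarkovSystem K V E)

/-- Contractiveness on average, with some rate `0 < a < 1`. -/
def IsContractive {K V E : Type*} [MetricSpace K] [MeasurableSpace K] [Fintype E]
    (𝓜 : MarkovSystem K V E) : Prop :=
  ∃ a : ℝ, 0 < a ∧ a < 1 ∧ ∀ i, ∀ x ∈ 𝓜.vset i, ∀ y ∈ 𝓜.vset i,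
    ∑ e, 𝓜.p e x * dist (𝓜.w e x) (𝓜.w e y) ≤ a * dist x y

/-- The Markov operator `U f = ∑ e, p_e · (f ∘ w_e)`. -/
def markovOp (f : K → ℝ) (x : K) : ℝ := ∑ e, 𝓜.p e x * f (𝓜.w e x)

/-- `μ` is an invariant probability measure, `U* μ = μ`: one has `∫ U f dμ = ∫ f dμ` for all bounded
Borel functions `f`. -/
def IsInvariant (μ : Measure K) : Prop :=
  IsProbabilityMeasure μ ∧ ∀ f : K → ℝ, Measurable f → (∃ C : ℝ, ∀ x, |f x| ≤ C) →
    ∫ x, 𝓜.markovOp f x ∂μ = ∫ x, f x ∂μ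

/-- `p_{e₁}(x) p_{e₂}(w_{e₁} x) ⋯ p_{eₖ}(w_{eₖ₋₁} ∘ ⋯ ∘ w_{e₁} x)` for the word `e₁ … eₖ`. -/
def pathProb : List E → K → ℝ
  | [], _ => 1
  | e :: l, x => 𝓜.p e x * pathProb l (𝓜.w e x)

/-- `M` is a generalized Markov measure associated with `𝓜` and `μ`: it has the prescribed values
on all cylinder sets. -/
def IsGeneralizedMarkovMeasure [MeasurableSpace E] (μ : Measure K) (M : Measure (ℤ → E)) : Prop :=
  ∀ (m : ℤ) (l : List E), M (codeCylinder m l) = ENNReal.ofReal (∫ x, 𝓜.pathProb l x ∂μ)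

/-! ### Existence of the generalized Markov measure -/

theorem pathProb_nonneg (l : List E) (x : K) : 0 ≤ 𝓜.pathProb l x := by
  induction l generalizing x with
  | nil => simp [pathProb]
  | cons e l ih => exact mul_nonneg (𝓜.p_nonneg e x) (ih _)

theorem pathProb_measurable (l : List E) : Measurable (𝓜.pathProb l) := by
  induction l with
  | nil => exact measurable_const
  | cons e l ih => exact (𝓜.p_measurable e).mul (ih.comp (𝓜.w_measurable e))

theorem p_le_one (e : E) (x : K) : 𝓜.p e x ≤ 1 := by
  rw [← 𝓜.p_sum x]
  exact Finset.single_le_sum (f := fun e => 𝓜.p e x) (fun i _ => 𝓜.p_nonneg i x)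
    (Finset.mem_univ e)

theorem pathProb_le_one (l : List E) (x : K) : 𝓜.pathProb l x ≤ 1 := by
  induction l generalizing x with
  | nil => simp [pathProb]
  | cons e l ih => exact mul_le_one₀ (𝓜.p_le_one e x) (𝓜.pathProb_nonneg l _) (ih _)

theorem markovOp_iterate_props (l : List E) (j : ℕ) :
    Measurable (𝓜.markovOp^[j] (𝓜.pathProb l)) ∧
      ∀ x, 0 ≤ 𝓜.markovOp^[j] (𝓜.pathProb l) x ∧ 𝓜.markovOp^[j] (𝓜.pathProb l) x ≤ 1 := by
  induction j with
  | zero => exact ⟨𝓜.pathProb_measurable l, fun x => ⟨𝓜.pathProb_nonneg l x, 𝓜.pathProb_le_one l x⟩⟩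
  | succ j ih =>
    rw [Function.iterate_succ_apply']
    refine ⟨Finset.measurable_sum _ fun e _ =>
      (𝓜.p_measurable e).mul (ih.1.comp (𝓜.w_measurable e)), fun x => ⟨?_, ?_⟩⟩
    · exact Finset.sum_nonneg fun e _ => mul_nonneg (𝓜.p_nonneg e x) (ih.2 _).1
    · rw [← 𝓜.p_sum x]
      exact Finset.sum_le_sum fun e _ => mul_le_of_le_one_right (𝓜.p_nonneg e x) (ih.2 _).2

theorem integral_markovOp_iterate {μ : Measure K} (hμ : 𝓜.IsInvariant μ) (l : List E) (j : ℕ) :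
    ∫ x, 𝓜.markovOp^[j] (𝓜.pathProb l) x ∂μ = ∫ x, 𝓜.pathProb l x ∂μ := by
  induction j with
  | zero => rfl
  | succ j ih =>
    rw [Function.iterate_succ_apply', ← ih]
    obtain ⟨h1, h2⟩ := 𝓜.markovOp_iterate_props l j
    exact hμ.2 _ h1 ⟨1, fun x => abs_le.2 ⟨by linarith [(h2 x).1], (h2 x).2⟩⟩

/-- Prefix the letter `e` to a one-sided sequence. -/
def consSeq (e : E) (τ : ℕ → E) : ℕ → E
  | 0 => e
  | n + 1 => τ n

/-- One-sided cylinder sets. -/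
def seqCylinder (j : ℕ) (l : List E) : Set (ℕ → E) :=
  {τ | ∀ (k : ℕ) (hk : k < l.length), τ (j + k) = l[k]}

theorem consSeq_preimage_succ (e : E) (j : ℕ) (l : List E) :
    consSeq e ⁻¹' seqCylinder (j + 1) l = seqCylinder j l := by
  ext τ
  simp only [seqCylinder, Set.mem_preimage, Set.mem_ofPred_eq]
  refine forall_congr' fun k => forall_congr' fun hk => ?_
  rw [show j + 1 + k = (j + k) + 1 by omega]
  rfl

theorem consSeq_preimage_zero (e a : E) (l : List E) :
    consSeq e ⁻¹' seqCylinder 0 (a :: l) = {τ | e = a ∧ τ ∈ seqCylinder 0 l} := by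
  ext τ
  simp only [seqCylinder, Set.mem_preimage, Set.mem_ofPred_eq]
  constructor
  · intro h
    refine ⟨h 0 (by simp), fun k hk => ?_⟩
    have := h (k + 1) (by simpa using hk)
    simpa [consSeq] using this
  · rintro ⟨h0, h⟩ k hk
    cases k with
    | zero => exact h0
    | succ k =>
      have := h k (by simpa using hk)
      simpa [consSeq] using this

section Existence

variable [MeasurableSpace E]

theorem measurable_consSeq (e : E) : Measurable (consSeq e) := by
  refine measurable_pi_lambda _ fun n => ?_
  cases n with
  | zero => exact measurable_const
  | succ n => exact measurable_pi_apply n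

/-- The law of the first `k` letters of the Markov process started at `x`, continued constantly. -/
def startLaw (e₀ : E) : ℕ → K → Measure (ℕ → E)
  | 0, _ => Measure.dirac fun _ => e₀
  | k + 1, x => ∑ e, ENNReal.ofReal (𝓜.p e x) • (startLaw e₀ k (𝓜.w e x)).map (consSeq e)

theorem startLaw_succ_apply (e₀ : E) (k : ℕ) (x : K) {A : Set (ℕ → E)} (hA : MeasurableSet A) :
    𝓜.startLaw e₀ (k + 1) x A =
      ∑ e, ENNReal.ofReal (𝓜.p e x) * 𝓜.startLaw e₀ k (𝓜.w e x) (consSeq e ⁻¹' A) := by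
  simp only [startLaw, Measure.finsetSum_apply, Measure.smul_apply, smul_eq_mul]
  exact Finset.sum_congr rfl fun e _ => by rw [Measure.map_apply (measurable_consSeq e) hA]

theorem startLaw_univ (e₀ : E) (k : ℕ) (x : K) : 𝓜.startLaw e₀ k x Set.univ = 1 := by
  induction k generalizing x with
  | zero => simp [startLaw]
  | succ k ih =>
    rw [startLaw_succ_apply _ _ _ _ MeasurableSet.univ]
    simp only [Set.preimage_univ, ih, mul_one]
    rw [← ENNReal.ofReal_sum_of_nonneg fun e _ => 𝓜.p_nonneg e x, 𝓜.p_sum, ENNReal.ofReal_one]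

theorem measurable_startLaw (e₀ : E) (k : ℕ) : Measurable (𝓜.startLaw e₀ k) := by
  induction k with
  | zero => exact measurable_const
  | succ k ih =>
    refine Measure.measurable_of_measurable_coe _ fun A hA => ?_
    simp only [startLaw_succ_apply _ _ _ _ hA]
    exact Finset.measurable_sum _ fun e _ => (𝓜.p_measurable e).ennreal_ofReal.mul
      ((Measure.measurable_coe (measurable_consSeq e hA)).comp (ih.comp (𝓜.w_measurable e)))

theorem measurableSet_seqCylinder [DiscreteMeasurableSpace E] (j : ℕ) (l : List E) :
    MeasurableSet (seqCylinder j l) := by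
  simp only [seqCylinder, Set.ofPred_forall]
  exact MeasurableSet.iInter fun k => MeasurableSet.iInter fun hk =>
    (MeasurableSet.of_discrete (s := {l[k]})).preimage (measurable_pi_apply (j + k))

theorem startLaw_seqCylinder [DiscreteMeasurableSpace E] (e₀ : E) (j k : ℕ) (l : List E)
    (h : j + l.length ≤ k) (x : K) : 𝓜.startLaw e₀ k x (seqCylinder j l) =
      ENNReal.ofReal (𝓜.markovOp^[j] (𝓜.pathProb l) x) := by
  induction j generalizing k x with
  | zero =>
    induction l generalizing k x with
    | nil =>
      have : seqCylinder (E := E) 0 [] = Set.univ := by ext; simp [seqCylinder]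
      rw [this, startLaw_univ]
      simp [pathProb]
    | cons a l ih =>
      obtain ⟨k, rfl⟩ : ∃ k', k = k' + 1 := ⟨k - 1, by simp at h; omega⟩
      rw [startLaw_succ_apply _ _ _ _ (measurableSet_seqCylinder _ _)]
      simp only [consSeq_preimage_zero]
      rw [Finset.sum_eq_single a]
      · simp only [true_and, Set.ofPred_mem_eq]
        rw [ih k (by simp at h ⊢; omega)]
        simp only [Function.iterate_zero, id_eq, pathProb]
        rw [ENNReal.ofReal_mul (𝓜.p_nonneg a x)]
      · intro b _ hb
        simp [hb]
      · simp
  | succ j ih =>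
    obtain ⟨k, rfl⟩ : ∃ k', k = k' + 1 := ⟨k - 1, by omega⟩
    rw [startLaw_succ_apply _ _ _ _ (measurableSet_seqCylinder _ _), Function.iterate_succ_apply']
    simp only [consSeq_preimage_succ]
    rw [markovOp, ENNReal.ofReal_sum_of_nonneg fun e _ =>
      mul_nonneg (𝓜.p_nonneg e x) ((𝓜.markovOp_iterate_props l j).2 _).1]
    refine Finset.sum_congr rfl fun e _ => ?_
    rw [ih k (by omega), ENNReal.ofReal_mul (𝓜.p_nonneg e x)]

/-- Approximations of the generalized Markov measure: the right values on the cylinder sets within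
the window from `-n` to `n - 1`. -/
theorem exists_approx [DiscreteMeasurableSpace E] {μ : Measure K} (hμ : 𝓜.IsInvariant μ) (n : ℕ) :
    ∃ M : ProbabilityMeasure (ℤ → E), ∀ (m : ℤ) (l : List E), -(n : ℤ) ≤ m →
      m + l.length ≤ n → (M : Measure (ℤ → E)) (codeCylinder m l) =
        ENNReal.ofReal (∫ x, 𝓜.pathProb l x ∂μ) := by
  have := hμ.1
  have hE : Nonempty E := by
    by_contra hne
    rw [not_nonempty_iff] at hne
    obtain ⟨x⟩ := μ.nonempty_of_neZero
    simpa using 𝓜.p_sum x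
  obtain ⟨e₀⟩ := hE
  let g : (ℕ → E) → (ℤ → E) := fun τ j => τ (j + n).toNat
  have hg : Measurable g := measurable_pi_lambda _ fun j => measurable_pi_apply _
  let B : Measure (ℕ → E) := μ.bind (𝓜.startLaw e₀ (2 * n))
  have hB : ∀ A, MeasurableSet A → B A = ∫⁻ x, 𝓜.startLaw e₀ (2 * n) x A ∂μ := fun A hA =>
    Measure.bind_apply hA (𝓜.measurable_startLaw e₀ _).aemeasurable
  have hprob : IsProbabilityMeasure (B.map g) := by
    constructor
    rw [Measure.map_apply hg MeasurableSet.univ, Set.preimage_univ, hB _ MeasurableSet.univ]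
    simp [startLaw_univ]
  refine ⟨⟨B.map g, hprob⟩, fun m l h1 h2 => ?_⟩
  have hpre : g ⁻¹' codeCylinder m l = seqCylinder (m + n).toNat l := by
    ext τ
    simp only [codeCylinder, seqCylinder, Set.mem_preimage, Set.mem_ofPred_eq, g]
    refine forall_congr' fun k => forall_congr' fun hk => ?_
    rw [show (m + k + n).toNat = (m + n).toNat + k by omega]
  have hmeas : MeasurableSet (codeCylinder m l) := by
    simp only [codeCylinder, Set.ofPred_forall]
    exact MeasurableSet.iInter fun k => MeasurableSet.iInter fun hk =>
      (MeasurableSet.of_discrete (s := {l[k]})).preimage (measurable_pi_apply (m + (k : ℤ)))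
  rw [ProbabilityMeasure.coe_mk, Measure.map_apply hg hmeas, hpre,
    hB _ (measurableSet_seqCylinder _ _)]
  obtain ⟨p1, p2⟩ := 𝓜.markovOp_iterate_props l (m + n).toNat
  simp only [𝓜.startLaw_seqCylinder e₀ (m + n).toNat (2 * n) l (by omega)]
  rw [← 𝓜.integral_markovOp_iterate hμ l (m + n).toNat, ofReal_integral_eq_lintegral_ofReal]
  · exact Integrable.of_bound p1.aestronglyMeasurable 1
      (Eventually.of_forall fun x => by
        rw [Real.norm_eq_abs, abs_of_nonneg (p2 x).1]; exact (p2 x).2)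
  · exact Eventually.of_forall fun x => (p2 x).1

theorem exists_isGeneralizedMarkovMeasure [DiscreteMeasurableSpace E] {μ : Measure K}
    (hμ : 𝓜.IsInvariant μ) : ∃ M : Measure (ℤ → E), 𝓜.IsGeneralizedMarkovMeasure μ M := by
  let _ : TopologicalSpace E := ⊥
  have : DiscreteTopology E := ⟨rfl⟩
  have : BorelSpace E := ⟨by rw [borel_eq_top_of_discrete]; ext s; simp [MeasurableSet.of_discrete]⟩
  choose M hM using fun n : ℕ => 𝓜.exists_approx hμ n
  obtain ⟨L, -, hL⟩ := isCompact_univ.exists_mapClusterPt (f := (atTop : Filter ℕ)) (u := M)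
    (by simp)
  obtain ⟨G, hG, hGL⟩ := mapClusterPt_iff_ultrafilter.1 hL
  refine ⟨L, fun m l => ?_⟩
  have hclopen : IsClopen (codeCylinder (E := E) m l) := by
    have : codeCylinder (E := E) m l = ⋂ k : Fin l.length, {σ | σ (m + k) = l[k]} := by
      ext σ
      simp [codeCylinder, Fin.forall_iff]
    rw [this]
    exact isClopen_iInter_of_finite fun k =>
      (isClopen_discrete {l[k]}).preimage (continuous_apply (m + (k : ℤ)))
  have h1 := ProbabilityMeasure.tendsto_measure_of_null_frontier_of_tendsto' hGL
    (E := codeCylinder m l) (by rw [hclopen.frontier_eq]; simp)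
  refine tendsto_nhds_unique h1 (tendsto_const_nhds.congr' ?_)
  filter_upwards [hG (eventually_ge_atTop (m.natAbs + l.length))] with n hn
  have : m.natAbs + l.length ≤ n := hn
  exact (hM n m l (by omega) (by omega)).symm

end Existence

/-- The generalized Markov measure `M` associated with `𝓜` and the invariant measure `μ`. It is the
unique measure with the prescribed values on the cylinder sets. -/
def generalizedMarkovMeasure [MeasurableSpace E] [DiscreteMeasurableSpace E] {μ : Measure K}
    (hμ : 𝓜.IsInvariant μ) : Measure (ℤ → E) :=
  Classical.choose (𝓜.exists_isGeneralizedMarkovMeasure hμ)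

theorem generalizedMarkovMeasure_spec [MeasurableSpace E] [DiscreteMeasurableSpace E]
    {μ : Measure K} (hμ : 𝓜.IsInvariant μ) :
    𝓜.IsGeneralizedMarkovMeasure μ (𝓜.generalizedMarkovMeasure hμ) :=
  Classical.choose_spec (𝓜.exists_isGeneralizedMarkovMeasure hμ)

/-! ### The coding map and the energy function -/

/-- The composition `w_{σ 0} ∘ w_{σ (-1)} ∘ ⋯ ∘ w_{σ (-n)}`. -/
def backComp (σ : ℤ → E) : ℕ → K → K
  | 0, y => 𝓜.w (σ 0) y
  | n + 1, y => backComp σ n (𝓜.w (σ (-((n : ℤ) + 1))) y)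

/-- The point `w_{σ 0} ∘ ⋯ ∘ w_{σ (-n)} (x_{i(σ (-n))})`. -/
def backPoint (x : V → K) (σ : ℤ → E) (n : ℕ) : K :=
  𝓜.backComp σ n (x (𝓜.init (σ (-(n : ℤ)))))

/-- The subshift of finite type `Σ_G` of all two-sided paths in the graph. -/
def pathSpace : Set (ℤ → E) :=
  {σ | ∀ j : ℤ, 𝓜.term (σ j) = 𝓜.init (σ (j + 1))}

/-- The set `D` of all paths along which the limit that defines the coding map exists. -/
def limitSet [TopologicalSpace K] (x : V → K) : Set (ℤ → E) :=
  {σ | σ ∈ 𝓜.pathSpace ∧ ∃ y : K, Tendsto (𝓜.backPoint x σ) atTop (𝓝 y)}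

/-- The shift invariant set `Y`, the intersection of all `S ^ j (D)`, `j ∈ ℤ`. -/
def codingDomain [TopologicalSpace K] (x : V → K) : Set (ℤ → E) :=
  ⋂ j : ℤ, shiftBy j '' 𝓜.limitSet x

open Classical in
/-- The coding map `F = F_{x_1, …, x_N}`: the limit of `w_{σ 0} ∘ ⋯ ∘ w_{σ (-n)} (x_{i(σ (-n))})`
where it exists, and some irrelevant point elsewhere. -/
def codingMap [TopologicalSpace K] (x : V → K) (σ : ℤ → E) : K :=
  if h : ∃ y : K, Tendsto (𝓜.backPoint x σ) atTop (𝓝 y) then h.choose else x (𝓜.init (σ 0))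

open Classical in
/-- The energy function `u`: `log p_{σ 1} (F σ)` on `Y`, and `-∞` off `Y`. -/
def energy [TopologicalSpace K] (x : V → K) (σ : ℤ → E) : EReal :=
  if σ ∈ 𝓜.codingDomain x then ((Real.log (𝓜.p (σ 1) (𝓜.codingMap x σ)) : ℝ) : EReal) else ⊥

end MarkovSystem

end

/-!
For an invariant `Θ` with `Θ(Y) = 1`, the numbers `q_k(e; σ) = p_e(backPoint x σ k)` are conditional
probability weights that depend on finitely many letters of the past and converge to `p_e(F σ)`.
The Gibbs inequality against the product of these weights along a word yields
`h_Θ(S) ≤ -∫ log q_k(σ 1; σ) dΘ`, and `k → ∞` gives `h_Θ(S) + Θ(u) ≤ 0`. A partition that is not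
coded by finitely many letters is treated as a noisy observation of one that is.

If equality holds, give one letter `e` the additional factor `1 + t 1_A`, with `A` an event of the
past, and normalise: the bound for the new weights cannot be better, so its derivative at `t = 0`
vanishes, which says that `p_e(F σ)` is the conditional probability of `σ 1 = e` given the past.
Hence `F (S ^ n σ)` is the Markov process of the system, the law of `F` under `Θ` is invariant, so
it is `μ`, and the cylinder sets have the measures prescribed for `M`.

For `M` itself, contractiveness makes the law of `backPoint x σ k` approach `μ`, jointly with the
next letter, so `F(M) = μ`; concavity of `-t log t` applied to the cylinder probabilities gives
`h_M(S) ≥ -∑ ∫ p_e log p_e dμ = -M(u)`.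
-/

noncomputable section

/-! ### Words, shifts and the past -/

section CodeSpaceLemmas

variable {E : Type*}

/-- The word `σ m, …, σ (m + n - 1)`. -/
def wordAt (m : ℤ) (n : ℕ) (σ : ℤ → E) : Fin n → E := fun j => σ (m + (j : ℕ))

/-- The sequence that carries the word `v` at the places `m, …, m + n - 1` and the filler `e₀`
elsewhere, a section of `wordAt m n`. -/
def extendWord (e₀ : E) (m : ℤ) {n : ℕ} (v : Fin n → E) : ℤ → E := fun j =>
  if h : m ≤ j ∧ j < m + n then v ⟨(j - m).toNat, by omega⟩ else e₀

/-- The past of a sequence up to time `0`, continued constantly: a retraction onto a copy of the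
one-sided code space, through which every function of the past factors. -/
def pastPart (σ : ℤ → E) : ℤ → E := fun j => σ (min j 0)

theorem extendWord_apply (e₀ : E) (m : ℤ) {n : ℕ} (v : Fin n → E) (j : Fin n) :
    extendWord e₀ m v (m + (j : ℕ)) = v j := by
  have := j.2
  rw [extendWord, dif_pos (by omega)]
  congr 1
  ext
  simp

theorem extendWord_wordAt (e₀ : E) (m : ℤ) (n : ℕ) (σ : ℤ → E) {j : ℤ} (h₁ : m ≤ j)
    (h₂ : j < m + n) : extendWord e₀ m (wordAt m n σ) j = σ j := by
  rw [extendWord, dif_pos ⟨h₁, h₂⟩, wordAt]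
  congr 1
  simp only
  omega

theorem apply_extendWord_of_dependsOn {β : Type*} {f : (ℤ → E) → β} {a b : ℤ}
    (hf : DependsOn f (Set.Icc a b)) (e₀ : E) {m : ℤ} {n : ℕ} (ha : m ≤ a) (hb : b < m + n)
    (σ : ℤ → E) : f (extendWord e₀ m (wordAt m n σ)) = f σ :=
  hf fun j hj => extendWord_wordAt e₀ m n σ (by grind) (by grind)

theorem apply_pastPart_of_dependsOn {β : Type*} {f : (ℤ → E) → β}
    (hf : DependsOn f (Set.Iic 0)) (σ : ℤ → E) : f (pastPart σ) = f σ :=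
  hf fun _ hj => congrArg σ (min_eq_left hj)

theorem shiftBy_shiftBy (i j : ℤ) (σ : ℤ → E) : shiftBy i (shiftBy j σ) = shiftBy (i + j) σ :=
  funext fun n => congrArg σ (by ring)

theorem shiftBy_zero (σ : ℤ → E) : shiftBy 0 σ = σ :=
  funext fun n => congrArg σ (add_zero n)

theorem leftShift_iterate (n : ℕ) (σ : ℤ → E) : leftShift^[n] σ = shiftBy n σ := by
  induction n with
  | zero => exact (shiftBy_zero σ).symm
  | succ n ih =>
    rw [Function.iterate_succ_apply', ih, leftShift, shiftBy_shiftBy, Nat.cast_succ, add_comm]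

theorem dependsOn_comp_shiftBy {β : Type*} {f : (ℤ → E) → β} {a b : ℤ}
    (hf : DependsOn f (Set.Icc a b)) (m : ℤ) :
    DependsOn (fun σ => f (shiftBy m σ)) (Set.Icc (a + m) (b + m)) :=
  fun _ _ h => hf fun j hj => h (j + m) ⟨by grind, by grind⟩

theorem codeCylinder_ofFn (m : ℤ) {n : ℕ} (v : Fin n → E) :
    codeCylinder m (List.ofFn v) = wordAt m n ⁻¹' {v} := by
  ext σ
  simp only [codeCylinder, List.length_ofFn, List.getElem_ofFn, Set.mem_ofPred_eq, Set.mem_preimage,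
    Set.mem_singleton_iff, funext_iff, Fin.forall_iff, wordAt]

theorem codeCylinder_append_singleton (m : ℤ) (l : List E) (e : E) :
    codeCylinder m (l ++ [e]) = codeCylinder m l ∩ {σ | σ (m + l.length) = e} := by
  ext σ
  simp only [codeCylinder, Set.mem_ofPred_eq, Set.mem_inter_iff, List.length_append,
    List.length_singleton]
  constructor
  · intro h
    refine ⟨fun k hk => ?_, ?_⟩
    · rw [h k (by omega), List.getElem_append_left hk]
    · rw [h l.length (by omega), List.getElem_concat_length rfl]
  · rintro ⟨hl, he⟩ k hk
    rcases (Nat.lt_succ_iff.1 hk).lt_or_eq with hlt | rfl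
    · rw [hl k hlt, List.getElem_append_left hlt]
    · rw [he, List.getElem_concat_length rfl]

theorem codeCylinder_cons (m : ℤ) (e : E) (l : List E) :
    codeCylinder m (e :: l) = {σ | σ m = e} ∩ leftShift ⁻¹' codeCylinder m l := by
  ext σ
  have hshift (k : ℕ) : leftShift σ (m + k) = σ (m + (k + 1 : ℕ)) :=
    congrArg σ (by push_cast; ring)
  simp only [codeCylinder, Set.mem_inter_iff, Set.mem_preimage, Set.mem_ofPred_eq, hshift]
  constructor
  · exact fun h => ⟨(congrArg σ (add_zero m).symm).trans (h 0 (Nat.succ_pos _)),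
      fun k hk => h (k + 1) (Nat.succ_lt_succ hk)⟩
  · rintro ⟨he, hl⟩ (_ | k) hk
    · exact (congrArg σ (add_zero m)).trans he
    · exact hl k (Nat.lt_of_succ_lt_succ hk)

theorem exists_dependsOn_of_mem_measurableCylinders [MeasurableSpace E] {A : Set (ℤ → E)}
    (hA : A ∈ measurableCylinders fun _ : ℤ => E) :
    ∃ N : ℕ, DependsOn (fun σ => σ ∈ A) (Set.Icc (-(N : ℤ)) N) := by
  obtain ⟨s, S, -, rfl⟩ := (mem_measurableCylinders _).1 hA
  refine ⟨s.sup Int.natAbs, fun σ τ h => ?_⟩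
  have : s.restrict σ = s.restrict τ := by
    funext ⟨i, hi⟩
    have : i.natAbs ≤ s.sup Int.natAbs := Finset.le_sup (f := Int.natAbs) hi
    exact h i ⟨by omega, by omega⟩
  simp only [mem_cylinder, this]

section Measurability

variable [MeasurableSpace E]

theorem measurable_shiftBy (m : ℤ) : Measurable (shiftBy m : (ℤ → E) → ℤ → E) :=
  measurable_pi_lambda _ fun n => measurable_pi_apply (n + m)

theorem measurable_wordAt (m : ℤ) (n : ℕ) : Measurable (wordAt m n : (ℤ → E) → Fin n → E) :=
  measurable_pi_lambda _ fun _ => measurable_pi_apply _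

theorem measurable_pastPart : Measurable (pastPart : (ℤ → E) → ℤ → E) :=
  measurable_pi_lambda _ fun _ => measurable_pi_apply _

theorem measurableSet_eq_letter [DiscreteMeasurableSpace E] (j : ℤ) (e : E) :
    MeasurableSet {σ : ℤ → E | σ j = e} :=
  (MeasurableSet.of_discrete (s := {e})).preimage (measurable_pi_apply j)

theorem measurable_of_dependsOn_Icc [Finite E] [DiscreteMeasurableSpace E] {β : Type*}
    [MeasurableSpace β] {f : (ℤ → E) → β} {a b : ℤ} (hf : DependsOn f (Set.Icc a b)) :
    Measurable f := by
  rcases isEmpty_or_nonempty E with hE | ⟨⟨e₀⟩⟩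
  · exact measurable_of_empty f
  have : f = (fun v => f (extendWord e₀ a v)) ∘ wordAt a (b + 1 - a).toNat :=
    funext fun σ => (apply_extendWord_of_dependsOn hf e₀ le_rfl (by omega) σ).symm
  rw [this]
  exact Measurable.comp (g := fun v => f (extendWord e₀ a v)) (measurable_of_finite _)
    (measurable_wordAt _ _)

/-- The shift by `m` as a measurable equivalence, used to change variables in integrals of
functions that need not be measurable. -/
def shiftEquiv (m : ℤ) : (ℤ → E) ≃ᵐ (ℤ → E) where
  toFun := shiftBy m
  invFun := shiftBy (-m)
  left_inv σ := by rw [shiftBy_shiftBy, neg_add_cancel, shiftBy_zero]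
  right_inv σ := by rw [shiftBy_shiftBy, add_neg_cancel, shiftBy_zero]
  measurable_toFun := measurable_shiftBy m
  measurable_invFun := measurable_shiftBy (-m)

theorem measurePreserving_shiftBy {Θ : Measure (ℤ → E)} (h : MeasurePreserving leftShift Θ Θ)
    (m : ℤ) : MeasurePreserving (shiftBy m) Θ Θ := by
  have hnat (n : ℕ) : MeasurePreserving (shiftBy (n : ℤ)) Θ Θ :=
    (funext (leftShift_iterate n) : leftShift^[n] = shiftBy (n : ℤ)) ▸ h.iterate n
  obtain ⟨n, rfl | rfl⟩ := m.eq_nat_or_neg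
  · exact hnat n
  · exact MeasurePreserving.symm (shiftEquiv (n : ℤ)) (hnat n)

theorem integral_comp_shiftBy {Θ : Measure (ℤ → E)} (h : MeasurePreserving leftShift Θ Θ) (m : ℤ)
    (f : (ℤ → E) → ℝ) : ∫ σ, f (shiftBy m σ) ∂Θ = ∫ σ, f σ ∂Θ :=
  (measurePreserving_shiftBy h m).integral_comp' (f := shiftEquiv m) f

theorem integral_sum_comp_shiftBy {Θ : Measure (ℤ → E)} (h : MeasurePreserving leftShift Θ Θ)
    {ι : Type*} (s : Finset ι) (m : ι → ℤ) {f : ι → (ℤ → E) → ℝ} (hf : ∀ i, Integrable (f i) Θ) :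
    ∫ σ, ∑ i ∈ s, f i (shiftBy (m i) σ) ∂Θ = ∑ i ∈ s, ∫ σ, f i σ ∂Θ := by
  have hint (i : ι) : Integrable (fun σ => f i (shiftBy (m i) σ)) Θ :=
    (measurePreserving_shiftBy h (m i)).integrable_comp_of_integrable (hf i)
  rw [integral_finsetSum s fun i _ => hint i]
  simp only [integral_comp_shiftBy h]

theorem integral_eq_sum_letter [Fintype E] [DiscreteMeasurableSpace E] {Θ : Measure (ℤ → E)}
    {f : (ℤ → E) → ℝ} (hf : Integrable f Θ) (j : ℤ) :
    ∫ σ, f σ ∂Θ = ∑ e, ∫ σ in {σ | σ j = e}, f σ ∂Θ := by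
  have hcover : ⋃ e : E, {σ : ℤ → E | σ j = e} = Set.univ := by ext; simp
  rw [← setIntegral_univ, ← hcover]
  exact integral_iUnion_fintype (measurableSet_eq_letter j)
    (fun e e' hee => Set.disjoint_left.2 fun σ h h' => hee (h.symm.trans h'))
    fun e => hf.integrableOn

end Measurability

section Measures

variable [Finite E] [MeasurableSpace E] [DiscreteMeasurableSpace E]

theorem ext_of_wordAt {Θ Θ' : Measure (ℤ → E)} [IsFiniteMeasure Θ]
    (h : ∀ (m : ℤ) (n : ℕ) (v : Fin n → E), Θ (wordAt m n ⁻¹' {v}) = Θ' (wordAt m n ⁻¹' {v})) :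
    Θ = Θ' := by
  have hw (m : ℤ) (n : ℕ) : Θ.map (wordAt m n) = Θ'.map (wordAt m n) :=
    Measure.ext_of_singleton fun v => by
      rw [Measure.map_apply (measurable_wordAt m n) (MeasurableSet.singleton v),
        Measure.map_apply (measurable_wordAt m n) (MeasurableSet.singleton v), h]
  rcases isEmpty_or_nonempty E with hE | ⟨⟨e₀⟩⟩
  · exact Subsingleton.elim _ _
  refine ext_of_generate_finite _ generateFrom_measurableCylinders.symm
    isPiSystem_measurableCylinders (fun A hA => ?_) ?_
  · obtain ⟨N, hN⟩ := exists_dependsOn_of_mem_measurableCylinders hA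
    have hA' : A = wordAt (-(N : ℤ)) (2 * N + 1) ⁻¹' {v | extendWord e₀ (-(N : ℤ)) v ∈ A} :=
      Set.ext fun σ =>
        (apply_extendWord_of_dependsOn hN e₀ le_rfl (by push_cast; omega) σ).symm.to_iff
    have hB : MeasurableSet {v : Fin (2 * N + 1) → E | extendWord e₀ (-(N : ℤ)) v ∈ A} :=
      Set.Finite.measurableSet (Set.toFinite _)
    rw [hA', ← Measure.map_apply (measurable_wordAt _ _) hB, hw,
      Measure.map_apply (measurable_wordAt _ _) hB]
  · simpa [Measure.map_apply (measurable_wordAt 0 0)] using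
      congrArg (fun ν => ν Set.univ) (hw 0 0)

theorem integral_eq_integral_of_forall_past {α β : Measure (ℤ → E)} [IsFiniteMeasure α]
    (h : ∀ (N : ℕ) (A : Set (ℤ → E)), DependsOn (fun σ => σ ∈ A) (Set.Icc (-(N : ℤ)) 0) →
      α A = β A) {g : (ℤ → E) → ℝ} (hg : Measurable g) (hdep : DependsOn g (Set.Iic 0)) :
    ∫ σ, g σ ∂α = ∫ σ, g σ ∂β := by
  have hpast : α.map pastPart = β.map pastPart := ext_of_wordAt fun m n v => by
    have hmeas := measurable_wordAt m n (MeasurableSet.singleton v)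
    rw [Measure.map_apply measurable_pastPart hmeas, Measure.map_apply measurable_pastPart hmeas]
    refine h m.natAbs _ fun σ τ hστ => ?_
    have : wordAt m n (pastPart σ) = wordAt m n (pastPart τ) :=
      funext fun j => hστ _ ⟨by omega, by omega⟩
    simp only [Set.mem_preimage, this]
  have hmap (γ : Measure (ℤ → E)) : ∫ σ, g σ ∂γ = ∫ σ, g σ ∂γ.map pastPart := by
    rw [integral_map measurable_pastPart.aemeasurable hg.aestronglyMeasurable]
    simp only [apply_pastPart_of_dependsOn hdep]
  rw [hmap α, hmap β, hpast]

end Measures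

theorem exists_label {X κ : Type*} (ξ : X → κ) (t : κ → Set X) :
    ∃ ζ : X → κ, (∀ x y, (∀ i, x ∈ t i ↔ y ∈ t i) → ζ x = ζ y) ∧
      {x | ξ x ≠ ζ x} ⊆ ⋃ i, symmDiff (t i) (ξ ⁻¹' {i}) := by
  classical
  rcases isEmpty_or_nonempty X with hX | ⟨⟨x₀⟩⟩
  · exact ⟨ξ, fun x => isEmptyElim x, by simp⟩
  refine ⟨fun x => if h : ∃ i, x ∈ t i ∧ ∀ j, x ∈ t j → j = i then h.choose else ξ x₀,
    fun x y h => by simp only [h], fun x hx => ?_⟩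
  by_contra hcon
  simp only [Set.mem_iUnion, Set.mem_symmDiff, Set.mem_preimage, Set.mem_singleton_iff,
    not_exists, not_or, not_and, not_not] at hcon
  have hex : ∃ i, x ∈ t i ∧ ∀ j, x ∈ t j → j = i :=
    ⟨ξ x, (hcon _).2 rfl, fun j hj => ((hcon j).1 hj).symm⟩
  exact hx (((hcon _).1 hex.choose_spec.1).trans (dif_pos hex).symm)

variable [MeasurableSpace E]

theorem exists_dependsOn_measure_symmDiff_lt (Θ : Measure (ℤ → E)) [IsFiniteMeasure Θ]
    {A : Set (ℤ → E)} (hA : MeasurableSet A) {ε : ℝ≥0∞} (hε : 0 < ε) :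
    ∃ (N : ℕ) (t : Set (ℤ → E)), DependsOn (fun σ => σ ∈ t) (Set.Icc (-(N : ℤ)) N) ∧
      Θ (symmDiff t A) < ε := by
  obtain ⟨t, ht, hlt⟩ := exists_measure_symmDiff_lt_of_generateFrom_isSetRing (μ := Θ)
    isSetRing_measurableCylinders
    ⟨{Set.univ}, Set.countable_singleton _, by
      simpa only [Set.singleton_subset_iff] using univ_mem_measurableCylinders fun _ : ℤ => E,
      by simp⟩
    generateFrom_measurableCylinders.symm hA hε
  obtain ⟨N, hN⟩ := exists_dependsOn_of_mem_measurableCylinders ht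
  exact ⟨N, t, hN, hlt⟩

theorem exists_dependsOn_measure_ne_lt (Θ : Measure (ℤ → E)) [IsFiniteMeasure Θ] {κ : Type*}
    [Finite κ] [MeasurableSpace κ] [MeasurableSingletonClass κ] {ξ : (ℤ → E) → κ}
    (hξ : Measurable ξ) {ε : ℝ≥0∞} (hε : 0 < ε) :
    ∃ (N : ℕ) (ζ : (ℤ → E) → κ), DependsOn ζ (Set.Icc (-(N : ℤ)) N) ∧
      Θ {σ | ξ σ ≠ ζ σ} < ε := by
  rcases isEmpty_or_nonempty κ with hκ | hκ
  · exact ⟨0, ξ, fun σ => isEmptyElim (ξ σ), by simpa [isEmptyElim] using hε⟩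
  have := Fintype.ofFinite κ
  have hε' : 0 < ε / Fintype.card κ := ENNReal.div_pos hε.ne' (ENNReal.natCast_ne_top _)
  choose N t hN ht using fun i => exists_dependsOn_measure_symmDiff_lt Θ
    (hξ (measurableSet_singleton i)) hε'
  obtain ⟨ζ, hζ, hsub⟩ := exists_label ξ t
  refine ⟨Finset.univ.sup N, ζ, fun σ τ h => hζ σ τ fun i => (hN i fun j hj => h j ?_).to_iff, ?_⟩
  · have : N i ≤ Finset.univ.sup N := Finset.le_sup (Finset.mem_univ i)
    exact ⟨by grind, by grind⟩
  · calc Θ {σ | ξ σ ≠ ζ σ} ≤ ∑ i, Θ (symmDiff (t i) (ξ ⁻¹' {i})) :=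
          (measure_mono hsub).trans (measure_iUnion_fintype_le _ _)
      _ < ∑ _i : κ, ε / Fintype.card κ :=
          ENNReal.sum_lt_sum_of_nonempty Finset.univ_nonempty fun i _ => ht i
      _ ≤ ε := by
          rw [Finset.sum_const, Finset.card_univ, nsmul_eq_mul]
          exact ENNReal.mul_div_le

end CodeSpaceLemmas

/-! ### The Gibbs inequality -/

section Gibbs

theorem negMulLog_add_mul_log_le {a q : ℝ} (ha : 0 ≤ a) (hq : 0 ≤ q) (haq : a ≠ 0 → 0 < q) :
    Real.negMulLog a + a * Real.log q ≤ q - a := by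
  rcases ha.eq_or_lt with rfl | ha
  · simpa using hq
  have hq := haq ha.ne'
  have hlog : Real.log q - Real.log a ≤ q / a - 1 := by
    rw [← Real.log_div hq.ne' ha.ne']
    exact Real.log_le_sub_one_of_pos (div_pos hq ha)
  calc Real.negMulLog a + a * Real.log q = a * (Real.log q - Real.log a) := by
        rw [Real.negMulLog]; ring
    _ ≤ a * (q / a - 1) := mul_le_mul_of_nonneg_left hlog ha.le
    _ = q - a := by field_simp

variable {X ι V : Type*} [MeasurableSpace X] [MeasurableSpace ι] [DiscreteMeasurableSpace ι]
  {Θ : Measure X} {ζ : X → ι}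

theorem integrable_comp_of_finite [Finite ι] [IsFiniteMeasure Θ] (hζ : Measurable ζ)
    (f : ι → ℝ) :
    Integrable (fun x => f (ζ x)) Θ :=
  (Integrable.of_finite (μ := Θ.map ζ) (f := f)).comp_measurable hζ

variable [Fintype ι]

theorem integral_comp_eq_sum [IsFiniteMeasure Θ] (hζ : Measurable ζ) (f : ι → ℝ) :
    ∫ x, f (ζ x) ∂Θ = ∑ j, Θ.real (ζ ⁻¹' {j}) * f j := by
  rw [← integral_map (f := f) hζ.aemeasurable (measurable_of_finite _).aestronglyMeasurable,
    integral_fintype .of_finite]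
  simp only [map_measureReal_apply hζ (MeasurableSet.singleton _), smul_eq_mul]

variable [IsProbabilityMeasure Θ]

theorem partitionEntropy_le_log_sub_integral_log (hζ : Measurable ζ) {Q : ι → ℝ} {C : ℝ}
    (hC : 0 < C) (hQ₀ : ∀ j, 0 ≤ Q j) (hQ : ∑ j, Q j ≤ C) (hpos : ∀ᵐ x ∂Θ, 0 < Q (ζ x)) :
    partitionEntropy Θ ζ ≤ Real.log C - ∫ x, Real.log (Q (ζ x)) ∂Θ := by
  have hsum : ∑ j, Θ.real (ζ ⁻¹' {j}) = 1 := by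
    simpa using (integral_comp_eq_sum (Θ := Θ) hζ fun _ => 1).symm
  have hterm (j : ι) : Real.negMulLog (Θ.real (ζ ⁻¹' {j})) + Θ.real (ζ ⁻¹' {j}) * Real.log (Q j) ≤
      Q j / C - Θ.real (ζ ⁻¹' {j}) + Θ.real (ζ ⁻¹' {j}) * Real.log C := by
    have hQj (h : Θ.real (ζ ⁻¹' {j}) ≠ 0) : 0 < Q j := by
      by_contra hcon
      refine h ((measureReal_eq_zero_iff (measure_ne_top _ _)).2 ?_)
      exact measure_mono_null (fun x (hx : ζ x = j) h' => hcon (hx ▸ h')) hpos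
    have hgibbs := negMulLog_add_mul_log_le measureReal_nonneg (div_nonneg (hQ₀ j) hC.le)
      fun h => div_pos (hQj h) hC
    rcases eq_or_ne (Θ.real (ζ ⁻¹' {j})) 0 with h | h
    · simp only [h, zero_mul] at hgibbs ⊢
      linarith
    · rw [Real.log_div (hQj h).ne' hC.ne'] at hgibbs
      linarith
  have := Finset.sum_le_sum fun j (_ : j ∈ Finset.univ) => hterm j
  rw [Finset.sum_add_distrib, Finset.sum_add_distrib, Finset.sum_sub_distrib, ← Finset.sum_mul,
    ← Finset.sum_div, hsum, ← integral_comp_eq_sum hζ] at this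
  rw [partitionEntropy]
  linarith [(div_le_one hC).2 hQ]

variable [Fintype V] [MeasurableSpace V] [DiscreteMeasurableSpace V]

-- The Gibbs inequality for the weights `∑ v, P v * T i v`, of which a single term is kept.
theorem partitionEntropy_le_of_hidden {η : X → V} (hζ : Measurable ζ) (hη : Measurable η)
    {P : V → ℝ} {T : ι → V → ℝ} {C : ℝ} (hC : 0 < C) (hP₀ : ∀ v, 0 ≤ P v) (hP : ∑ v, P v ≤ C)
    (hT₀ : ∀ i v, 0 < T i v) (hT : ∀ v, ∑ i, T i v ≤ 1) (hpos : ∀ᵐ x ∂Θ, 0 < P (η x)) :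
    partitionEntropy Θ ζ ≤
      Real.log C - ∫ x, Real.log (P (η x)) ∂Θ - ∫ x, Real.log (T (ζ x) (η x)) ∂Θ := by
  have hterm (i : ι) (v : V) : 0 ≤ P v * T i v := mul_nonneg (hP₀ v) (hT₀ i v).le
  have hle (x : X) : P (η x) * T (ζ x) (η x) ≤ ∑ v, P v * T (ζ x) v :=
    Finset.single_le_sum (f := fun v => P v * T (ζ x) v) (fun v _ => hterm _ v)
      (Finset.mem_univ (η x))
  have hQ : ∑ i, ∑ v, P v * T i v ≤ C := by
    rw [Finset.sum_comm]
    simp only [← Finset.mul_sum]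
    exact (Finset.sum_le_sum fun v _ => mul_le_of_le_one_right (hP₀ v) (hT v)).trans hP
  have hiP := integrable_comp_of_finite (Θ := Θ) hη fun v => Real.log (P v)
  have hiT := integrable_comp_of_finite (Θ := Θ) (hζ.prodMk hη) fun u => Real.log (T u.1 u.2)
  have hlog : ∫ x, Real.log (P (η x)) ∂Θ + ∫ x, Real.log (T (ζ x) (η x)) ∂Θ ≤
      ∫ x, Real.log (∑ v, P v * T (ζ x) v) ∂Θ := by
    rw [← integral_add hiP hiT]
    refine integral_mono_ae (hiP.add hiT)
      (integrable_comp_of_finite hζ fun i => Real.log (∑ v, P v * T i v)) ?_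
    filter_upwards [hpos] with x hx
    rw [← Real.log_mul hx.ne' (hT₀ _ _).ne']
    exact Real.log_le_log (mul_pos hx (hT₀ _ _)) (hle x)
  have := partitionEntropy_le_log_sub_integral_log hζ hC
    (fun i => Finset.sum_nonneg fun v _ => hterm i v) hQ
    (hpos.mono fun x hx => (mul_pos hx (hT₀ _ _)).trans_le (hle x))
  linarith

end Gibbs

/-! ### An upper bound for the entropy of the shift -/

/-- Finite-memory prediction of the next letter: `q k e σ` is the weight given to the letter `e` at
time `1` on the basis of the letters `σ (-k), …, σ 0`. The weights of the letters may sum to less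
than `1`. -/
structure IsPastWeights {E : Type*} [Fintype E] (q : ℕ → E → (ℤ → E) → ℝ) : Prop where
  dependsOn : ∀ k e, DependsOn (q k e) (Set.Icc (-(k : ℤ)) 0)
  nonneg : ∀ k e σ, 0 ≤ q k e σ
  sum_le_one : ∀ k σ, ∑ e, q k e σ ≤ 1

/-- The weight of the word `σ m, …, σ (m + n)` given its first letter, each further letter being
predicted from all the letters of the word before it. -/
def wordWeight {E : Type*} (q : ℕ → E → (ℤ → E) → ℝ) (m : ℤ) (n : ℕ) (σ : ℤ → E) : ℝ :=
  ∏ k ∈ Finset.range n, q k (σ (m + k + 1)) (shiftBy (m + k) σ)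

namespace IsPastWeights

variable {E : Type*} [Fintype E] {q : ℕ → E → (ℤ → E) → ℝ}

theorem le_one (hq : IsPastWeights q) (k : ℕ) (e : E) (σ : ℤ → E) : q k e σ ≤ 1 :=
  (Finset.single_le_sum (f := fun e => q k e σ) (fun e _ => hq.nonneg k e σ)
    (Finset.mem_univ e)).trans (hq.sum_le_one k σ)

theorem dependsOn_next (hq : IsPastWeights q) (k : ℕ) :
    DependsOn (fun σ => q k (σ 1) σ) (Set.Icc (-(k : ℤ)) 1) := fun σ τ h => by
  simp only [h 1 ⟨by omega, le_rfl⟩]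
  exact hq.dependsOn k (τ 1) fun j hj => h j ⟨hj.1, hj.2.trans zero_le_one⟩

theorem wordWeight_nonneg (hq : IsPastWeights q) (m : ℤ) (n : ℕ) (σ : ℤ → E) :
    0 ≤ wordWeight q m n σ :=
  Finset.prod_nonneg fun _ _ => hq.nonneg _ _ _

theorem dependsOn_wordWeight (hq : IsPastWeights q) (m : ℤ) (n : ℕ) :
    DependsOn (wordWeight q m n) (Set.Icc m (m + n)) := fun σ τ h =>
  Finset.prod_congr rfl fun k hk => by
    have := Finset.mem_range.1 hk
    rw [h (m + k + 1) ⟨by omega, by omega⟩]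
    exact hq.dependsOn k _ fun j hj => h _ ⟨by grind, by grind⟩

theorem sum_wordWeight_extendWord_le (hq : IsPastWeights q) (e₀ : E) (m : ℤ) (n : ℕ) :
    ∑ v : Fin (n + 1) → E, wordWeight q m n (extendWord e₀ m v) ≤ Fintype.card E := by
  induction n with
  | zero => simp [wordWeight]
  | succ n ih =>
    rw [← (Fin.snocEquiv fun _ : Fin (n + 1 + 1) => E).sum_comp, Fintype.sum_prod_type_right]
    refine le_trans (Finset.sum_le_sum fun v _ => ?_) ih
    let snoc (e : E) : Fin (n + 1 + 1) → E := Fin.snoc (α := fun _ => E) v e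
    have hinit (e : E) (j : ℤ) (h₁ : m ≤ j) (h₂ : j ≤ m + n) :
        extendWord e₀ m (snoc e) j = extendWord e₀ m v j := by
      rw [extendWord, extendWord, dif_pos (by push_cast; omega), dif_pos (by push_cast; omega)]
      exact Fin.snoc_castSucc (α := fun _ => E) e v ⟨(j - m).toNat, by omega⟩
    have hlast (e : E) : extendWord e₀ m (snoc e) (m + n + 1) = e := by
      have := extendWord_apply e₀ m (snoc e) (Fin.last (n + 1))
      rwa [show snoc e (Fin.last (n + 1)) = e from Fin.snoc_last (α := fun _ => E) e v,
        Fin.val_last, Nat.cast_succ, ← add_assoc] at this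
    have hstep (e : E) : wordWeight q m (n + 1) (extendWord e₀ m (snoc e)) =
        wordWeight q m n (extendWord e₀ m v) * q n e (shiftBy (m + n) (extendWord e₀ m v)) := by
      rw [wordWeight, Finset.prod_range_succ, hlast]
      congr 1
      · exact hq.dependsOn_wordWeight m n fun j hj => hinit e j hj.1 hj.2
      · exact hq.dependsOn n e fun j hj => hinit e _ (by grind) (by grind)
    calc ∑ e, wordWeight q m (n + 1) (extendWord e₀ m (snoc e))
        = wordWeight q m n (extendWord e₀ m v) *
            ∑ e, q n e (shiftBy (m + n) (extendWord e₀ m v)) := by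
          simp only [hstep, Finset.mul_sum]
      _ ≤ wordWeight q m n (extendWord e₀ m v) :=
          mul_le_of_le_one_right (hq.wordWeight_nonneg m n _) (hq.sum_le_one n _)

end IsPastWeights

section EntropyBound

variable {E : Type*} [MeasurableSpace E] {Θ : Measure (ℤ → E)} {q : ℕ → E → (ℤ → E) → ℝ}

theorem ae_forall_pos_comp_shiftBy (hΘ : MeasurePreserving leftShift Θ Θ)
    (hpos : ∀ k, ∀ᵐ σ ∂Θ, 0 < q k (σ 1) σ) (m : ℤ) :
    ∀ᵐ σ ∂Θ, ∀ k : ℕ, 0 < q k (σ (m + k + 1)) (shiftBy (m + k) σ) :=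
  ae_all_iff.2 fun k => by
    have := (measurePreserving_shiftBy hΘ (m + k)).quasiMeasurePreserving.ae (hpos k)
    simpa only [shiftBy, add_comm (1 : ℤ)] using this

theorem integral_log_prod_kernel {κ : Type*} [Finite κ] [MeasurableSpace κ]
    [DiscreteMeasurableSpace κ] [IsFiniteMeasure Θ] {ξ ζ : (ℤ → E) → κ} {c : κ → κ → ℝ}
    (hΘ : MeasurePreserving leftShift Θ Θ) (hξ : Measurable ξ) (hζ : Measurable ζ)
    (hc₀ : ∀ i j, 0 < c i j) (n : ℕ) :
    ∫ σ, Real.log (∏ j : Fin n, c (itinerary leftShift ξ n σ j) (ζ (shiftBy (j : ℕ) σ))) ∂Θ =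
      n * ∫ σ, Real.log (c (ξ σ) (ζ σ)) ∂Θ := by
  have hint : Integrable (fun σ => Real.log (c (ξ σ) (ζ σ))) Θ :=
    integrable_comp_of_finite (hξ.prodMk hζ) fun u => Real.log (c u.1 u.2)
  simp only [itinerary, leftShift_iterate, Real.log_prod fun _ _ => (hc₀ _ _).ne']
  rw [integral_sum_comp_shiftBy hΘ Finset.univ (fun j : Fin n => ((j : ℕ) : ℤ)) fun _ => hint,
    Finset.sum_const, Finset.card_univ, Fintype.card_fin, nsmul_eq_mul]

variable [DiscreteMeasurableSpace E]

theorem integrable_of_dependsOn_Icc [Finite E] [IsFiniteMeasure Θ] {f : (ℤ → E) → ℝ} {a b : ℤ}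
    (hf : DependsOn f (Set.Icc a b)) : Integrable f Θ := by
  rcases isEmpty_or_nonempty E with hE | ⟨⟨e₀⟩⟩
  · exact Integrable.of_isEmpty
  refine (integrable_comp_of_finite (measurable_wordAt a (b + 1 - a).toNat)
    fun v => f (extendWord e₀ a v)).congr (ae_of_all _ fun σ => ?_)
  exact apply_extendWord_of_dependsOn hf e₀ le_rfl (by omega) σ

theorem exists_kernel (κ : Type*) [Fintype κ] [DecidableEq κ] {ε : ℝ} (hε : 0 < ε) :
    ∃ c : κ → κ → ℝ, (∀ i j, 0 < c i j) ∧ (∀ j, ∑ i, c i j ≤ 1) ∧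
      ∃ L, 0 ≤ L ∧ ∀ i j, (if i = j then -ε else -L) ≤ Real.log (c i j) := by
  rcases isEmpty_or_nonempty κ with hκ | hκ
  · exact ⟨fun _ _ => 0, isEmptyElim, isEmptyElim, 0, le_rfl, isEmptyElim⟩
  have hcard : (1 : ℝ) ≤ Fintype.card κ := by exact_mod_cast Fintype.card_pos (α := κ)
  have hη : 0 < 1 - Real.exp (-ε) := sub_pos.2 (Real.exp_lt_one_iff.2 (neg_lt_zero.2 hε))
  have hη' : 0 < (1 - Real.exp (-ε)) / Fintype.card κ := div_pos hη (by linarith)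
  have hη_le : (1 - Real.exp (-ε)) / Fintype.card κ ≤ 1 :=
    (div_le_self hη.le hcard).trans (by linarith [Real.exp_pos (-ε)])
  refine ⟨fun i j => if i = j then Real.exp (-ε) else (1 - Real.exp (-ε)) / Fintype.card κ,
    fun i j => ?_, fun j => ?_, -Real.log ((1 - Real.exp (-ε)) / Fintype.card κ),
    neg_nonneg.2 (Real.log_nonpos hη'.le hη_le), fun i j => ?_⟩
  · beta_reduce
    split_ifs
    exacts [Real.exp_pos _, hη']
  · calc ∑ i, (if i = j then Real.exp (-ε) else (1 - Real.exp (-ε)) / Fintype.card κ)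
        ≤ ∑ i, ((if i = j then Real.exp (-ε) else 0) + (1 - Real.exp (-ε)) / Fintype.card κ) :=
          Finset.sum_le_sum fun i _ => by split_ifs <;> linarith
      _ = 1 := by
          rw [Finset.sum_add_distrib, Finset.sum_ite_eq' Finset.univ j, if_pos (Finset.mem_univ j),
            Finset.sum_const, Finset.card_univ, nsmul_eq_mul, mul_div_cancel₀ _ (by linarith)]
          ring
  · beta_reduce
    split_ifs <;> simp

-- `c (ξ σ) (ζ σ)` predicts `ξ σ` from `ζ σ`; with a good approximation `ζ` of `ξ` by a function of
-- finitely many letters, this costs little.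
theorem exists_le_integral_log_kernel [Finite E] {κ : Type*} [Fintype κ] [MeasurableSpace κ]
    [DiscreteMeasurableSpace κ] [IsProbabilityMeasure Θ] {ξ : (ℤ → E) → κ} (hξ : Measurable ξ)
    {ε : ℝ} (hε : 0 < ε) :
    ∃ (N : ℕ) (ζ : (ℤ → E) → κ) (c : κ → κ → ℝ), DependsOn ζ (Set.Icc (-(N : ℤ)) N) ∧
      (∀ i j, 0 < c i j) ∧ (∀ j, ∑ i, c i j ≤ 1) ∧
      -ε ≤ ∫ σ, Real.log (c (ξ σ) (ζ σ)) ∂Θ := by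
  classical
  obtain ⟨c, hc₀, hc, L, hL, hlog⟩ := exists_kernel κ (half_pos hε)
  obtain ⟨N, ζ, hζ, hne⟩ := exists_dependsOn_measure_ne_lt Θ hξ
    (ε := ENNReal.ofReal (ε / (2 * (L + 1)))) (ENNReal.ofReal_pos.2 (by positivity))
  refine ⟨N, ζ, c, hζ, hc₀, hc, ?_⟩
  have hζm := measurable_of_dependsOn_Icc hζ
  have hmeas : MeasurableSet {σ | ξ σ ≠ ζ σ} := (measurableSet_eq_fun hξ hζm).compl
  have hsmall : L * Θ.real {σ | ξ σ ≠ ζ σ} ≤ ε / 2 :=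
    calc L * Θ.real {σ | ξ σ ≠ ζ σ} ≤ L * (ε / (2 * (L + 1))) := mul_le_mul_of_nonneg_left
          (ENNReal.toReal_le_of_le_ofReal (by positivity) hne.le) hL
      _ = L / (L + 1) * (ε / 2) := by field_simp
      _ ≤ ε / 2 := mul_le_of_le_one_left (by positivity)
          ((div_le_one (by positivity)).2 (by linarith))
  have hind : Integrable ({σ | ξ σ ≠ ζ σ}.indicator fun _ => L) Θ :=
    (integrable_const L).indicator hmeas
  calc -ε ≤ -(ε / 2) - L * Θ.real {σ | ξ σ ≠ ζ σ} := by linarith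
    _ = ∫ σ, (-(ε / 2) - {σ | ξ σ ≠ ζ σ}.indicator (fun _ => L) σ) ∂Θ := by
        rw [integral_sub (integrable_const _) hind, integral_indicator_const L hmeas]
        simp [mul_comm]
    _ ≤ ∫ σ, Real.log (c (ξ σ) (ζ σ)) ∂Θ := by
        refine integral_mono ((integrable_const _).sub hind)
          (integrable_comp_of_finite (hξ.prodMk hζm) fun u => Real.log (c u.1 u.2)) fun σ => ?_
        have := hlog (ξ σ) (ζ σ)
        by_cases h : ξ σ = ζ σ
        · simpa [h] using this
        · rw [if_neg h] at this
          rw [Set.indicator_of_mem (by exact h)]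
          linarith

variable [Fintype E]

theorem integral_log_wordWeight [IsFiniteMeasure Θ] (hΘ : MeasurePreserving leftShift Θ Θ)
    (hq : IsPastWeights q) (hpos : ∀ k, ∀ᵐ σ ∂Θ, 0 < q k (σ 1) σ) (m : ℤ) (n : ℕ) :
    ∫ σ, Real.log (wordWeight q m n σ) ∂Θ =
      ∑ k ∈ Finset.range n, ∫ σ, Real.log (q k (σ 1) σ) ∂Θ := by
  have hlog : ∀ᵐ σ ∂Θ, Real.log (wordWeight q m n σ) =
      ∑ k ∈ Finset.range n, Real.log (q k (shiftBy (m + k) σ 1) (shiftBy (m + k) σ)) := by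
    filter_upwards [ae_forall_pos_comp_shiftBy hΘ hpos m] with σ hσ
    rw [wordWeight, Real.log_prod fun k _ => (hσ k).ne']
    simp only [shiftBy, add_comm (1 : ℤ)]
  have hint (k : ℕ) : Integrable (fun σ => Real.log (q k (σ 1) σ)) Θ :=
    integrable_of_dependsOn_Icc fun _ _ h => congrArg Real.log (hq.dependsOn_next k h)
  rw [integral_congr_ae hlog]
  exact integral_sum_comp_shiftBy hΘ _ (fun k : ℕ => m + k) hint

theorem sum_prod_kernel_le_one {κ ι : Type*} [Fintype κ] [Fintype ι] [DecidableEq ι]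
    {c : κ → κ → ℝ} (hc₀ : ∀ i j, 0 < c i j) (hc : ∀ j, ∑ i, c i j ≤ 1) (v : ι → κ) :
    ∑ l : ι → κ, ∏ a, c (l a) (v a) ≤ 1 := by
  rw [← Fintype.piFinset_univ,
    ← Finset.prod_univ_sum (fun _ : ι => Finset.univ) fun a i => c i (v a)]
  exact Finset.prod_le_one (fun a _ => Finset.sum_nonneg fun i _ => (hc₀ _ _).le) fun a _ => hc _

variable {κ : Type*} [Fintype κ] [MeasurableSpace κ] [DiscreteMeasurableSpace κ]
  [IsProbabilityMeasure Θ] {ξ : (ℤ → E) → κ} {N : ℕ} {ζ : (ℤ → E) → κ} {c : κ → κ → ℝ}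

theorem partitionEntropy_itinerary_le (hΘ : MeasurePreserving leftShift Θ Θ)
    (hq : IsPastWeights q) (hpos : ∀ k, ∀ᵐ σ ∂Θ, 0 < q k (σ 1) σ) (hξ : Measurable ξ)
    (hζ : DependsOn ζ (Set.Icc (-(N : ℤ)) N)) (hc₀ : ∀ i j, 0 < c i j)
    (hc : ∀ j, ∑ i, c i j ≤ 1) (n : ℕ) :
    partitionEntropy Θ (itinerary leftShift ξ n) ≤ Real.log (Fintype.card E) -
      ∑ k ∈ Finset.range (n + 2 * N), ∫ σ, Real.log (q k (σ 1) σ) ∂Θ -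
      n * ∫ σ, Real.log (c (ξ σ) (ζ σ)) ∂Θ := by
  obtain ⟨σ₀⟩ := Θ.nonempty_of_neZero
  have : Nonempty E := ⟨σ₀ 0⟩
  let ext : (Fin (n + 2 * N + 1) → E) → ℤ → E := extendWord (σ₀ 0) (-(N : ℤ))
  let word : (ℤ → E) → Fin (n + 2 * N + 1) → E := wordAt (-(N : ℤ)) (n + 2 * N + 1)
  let P (v : Fin (n + 2 * N + 1) → E) : ℝ :=
    wordWeight q (-(N : ℤ)) (n + 2 * N) (ext v)
  let T (l : Fin n → κ) (v : Fin (n + 2 * N + 1) → E) : ℝ :=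
    ∏ j : Fin n, c (l j) (ζ (shiftBy (j : ℕ) (ext v)))
  have hPw (σ : ℤ → E) : P (word σ) = wordWeight q (-(N : ℤ)) (n + 2 * N) σ :=
    apply_extendWord_of_dependsOn (hq.dependsOn_wordWeight _ _) _ le_rfl (by push_cast; omega) σ
  have hTw (l : Fin n → κ) (σ : ℤ → E) : T l (word σ) =
      ∏ j : Fin n, c (l j) (ζ (shiftBy (j : ℕ) σ)) :=
    Finset.prod_congr rfl fun j _ => congrArg (c (l j)) (apply_extendWord_of_dependsOn
      (dependsOn_comp_shiftBy hζ (j : ℕ)) _ (by omega) (by push_cast; omega) σ)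
  have hww : ∀ᵐ σ ∂Θ, 0 < wordWeight q (-(N : ℤ)) (n + 2 * N) σ :=
    (ae_forall_pos_comp_shiftBy hΘ hpos _).mono fun σ hσ => Finset.prod_pos fun k _ => hσ k
  have hitin : Measurable (itinerary leftShift ξ n) :=
    measurable_pi_lambda _ fun j => hξ.comp (hΘ.measurable.iterate j)
  refine (partitionEntropy_le_of_hidden (η := word) (T := T) (P := P) hitin (measurable_wordAt _ _)
    (by exact_mod_cast Fintype.card_pos) (fun v => hq.wordWeight_nonneg _ _ _)
    (hq.sum_wordWeight_extendWord_le (σ₀ 0) _ _) (fun l v => Finset.prod_pos fun j _ => hc₀ _ _)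
    (fun v => sum_prod_kernel_le_one hc₀ hc _) (hww.mono fun σ hσ => (hPw σ).symm ▸ hσ)).trans_eq ?_
  simp only [hPw, hTw]
  rw [integral_log_wordWeight hΘ hq hpos,
    integral_log_prod_kernel hΘ hξ (measurable_of_dependsOn_Icc hζ) hc₀]

theorem limsup_div_le_of_le_sum {H I : ℕ → ℝ} {a ε C : ℝ} {N : ℕ} (hI : Tendsto I atTop (𝓝 a))
    (hH : ∀ n : ℕ, H n ≤ C + ∑ k ∈ Finset.range (n + N), I k + n * ε) :
    limsup (fun n : ℕ => ((H n / n : ℝ) : EReal)) atTop ≤ ((a + ε : ℝ) : EReal) := by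
  let b (n : ℕ) : ℝ := (C + ∑ k ∈ Finset.range N, I k) * (n : ℝ)⁻¹ +
    (n : ℝ)⁻¹ * ∑ k ∈ Finset.range n, I (k + N) + ε
  have hb : Tendsto b atTop (𝓝 (a + ε)) := by
    have := (((tendsto_inv_atTop_nhds_zero_nat (𝕜 := ℝ)).const_mul
      (C + ∑ k ∈ Finset.range N, I k)).add
        ((tendsto_add_atTop_iff_nat N).2 hI).cesaro).add_const ε
    rwa [mul_zero, zero_add] at this
  have hHb : ∀ᶠ n : ℕ in atTop, ((H n / n : ℝ) : EReal) ≤ (b n : EReal) := by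
    filter_upwards [eventually_gt_atTop 0] with n hn
    have hn' : (0 : ℝ) < n := by exact_mod_cast hn
    refine EReal.coe_le_coe_iff.2 ((div_le_iff₀ hn').2 ((hH n).trans_eq ?_))
    rw [add_comm n, Finset.sum_range_add]
    simp only [b, add_comm N]
    field_simp
    ring
  exact (limsup_le_limsup hHb).trans_eq ((continuous_coe_real_ereal.tendsto _).comp hb).limsup_eq

theorem tendsto_integral_log_next (hq : IsPastWeights q) {r : (ℤ → E) → ℝ} {c : ℝ} (hc : 0 < c)
    (hlow : ∀ᵐ σ ∂Θ, ∀ k, c ≤ q k (σ 1) σ)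
    (hlim : ∀ᵐ σ ∂Θ, Tendsto (fun k => q k (σ 1) σ) atTop (𝓝 (r σ))) :
    Tendsto (fun k => ∫ σ, Real.log (q k (σ 1) σ) ∂Θ) atTop (𝓝 (∫ σ, Real.log (r σ) ∂Θ)) := by
  refine tendsto_integral_of_dominated_convergence (fun _ => -Real.log c)
    (fun k => (measurable_of_dependsOn_Icc fun _ _ h =>
      congrArg Real.log (hq.dependsOn_next k h)).aestronglyMeasurable) (integrable_const _)
    (fun k => ?_) ?_
  · filter_upwards [hlow] with σ hσ
    rw [Real.norm_eq_abs, abs_of_nonpos (Real.log_nonpos (hq.nonneg k _ σ) (hq.le_one k _ σ))]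
    exact neg_le_neg (Real.log_le_log hc (hσ k))
  · filter_upwards [hlow, hlim] with σ h₁ h₂
    exact h₂.log (hc.trans_le (ge_of_tendsto' h₂ h₁)).ne'

theorem ksEntropy_leftShift_le (hΘ : MeasurePreserving leftShift Θ Θ) (hq : IsPastWeights q)
    {r : (ℤ → E) → ℝ} {c : ℝ} (hc : 0 < c) (hlow : ∀ᵐ σ ∂Θ, ∀ k, c ≤ q k (σ 1) σ)
    (hlim : ∀ᵐ σ ∂Θ, Tendsto (fun k => q k (σ 1) σ) atTop (𝓝 (r σ))) :
    ksEntropy Θ leftShift ≤ ((-∫ σ, Real.log (r σ) ∂Θ : ℝ) : EReal) := by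
  refine iSup_le fun d => iSup_le fun ξ => iSup_le fun hξ => EReal.le_of_forall_lt_iff_le.1 ?_
  intro z hz
  have hε : 0 < z + ∫ σ, Real.log (r σ) ∂Θ := by
    linarith [EReal.coe_lt_coe_iff.1 hz]
  obtain ⟨N, ζ, κ, hζ, hκ₀, hκ, hcost⟩ := exists_le_integral_log_kernel (Θ := Θ) hξ hε
  have hI := (tendsto_integral_log_next hq hc hlow hlim).neg
  refine (limsup_div_le_of_le_sum (C := Real.log (Fintype.card E)) (N := 2 * N)
    (ε := z + ∫ σ, Real.log (r σ) ∂Θ) hI fun n => ?_).trans_eq (by rw [neg_add_cancel_comm_assoc])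
  have hH := partitionEntropy_itinerary_le hΘ hq
    (fun k => hlow.mono fun σ h => hc.trans_le (h k)) hξ hζ hκ₀ hκ n
  have := mul_le_mul_of_nonneg_left hcost n.cast_nonneg
  rw [Finset.sum_neg_distrib]
  linarith

end EntropyBound

/-! ### The equality case -/

section EqualityCase

theorem sub_two_mul_sq_le_log {t : ℝ} (ht : |t| ≤ 1 / 2) : t - 2 * t ^ 2 ≤ Real.log (1 + t) := by
  obtain ⟨h₁, -⟩ := abs_le.1 ht
  have hpos : 0 < 1 + t := by linarith
  refine le_trans ?_ (Real.one_sub_inv_le_log_of_pos hpos)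
  have : 1 - (1 + t)⁻¹ - (t - 2 * t ^ 2) = t ^ 2 * (1 + 2 * t) / (1 + t) := by
    field_simp
    ring
  have : 0 ≤ t ^ 2 * (1 + 2 * t) / (1 + t) :=
    div_nonneg (mul_nonneg (sq_nonneg t) (by linarith)) hpos.le
  linarith

theorem eq_of_forall_mul_sub_sq_le {a b : ℝ}
    (h : ∀ s, |s| ≤ 1 / 2 → s * a - 2 * s ^ 2 ≤ s * b) : a = b := by
  by_contra hne
  have hD : 0 < (a - b) ^ 2 := sq_pos_of_ne_zero (sub_ne_zero.2 hne)
  have hC : 1 < |a - b| + 1 := by linarith [abs_pos.2 (sub_ne_zero.2 hne)]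
  have hs : |(a - b) / (2 * (|a - b| + 1))| ≤ 1 / 2 := by
    rw [abs_div, abs_of_pos (by linarith : 0 < 2 * (|a - b| + 1)), div_le_div_iff₀] <;> linarith
  have hle := h _ hs
  have : (a - b) / (2 * (|a - b| + 1)) * a - 2 * ((a - b) / (2 * (|a - b| + 1))) ^ 2 -
      (a - b) / (2 * (|a - b| + 1)) * b =
        (a - b) ^ 2 * |a - b| / (2 * (|a - b| + 1) ^ 2) := by
    field_simp
    ring
  have : 0 < (a - b) ^ 2 * |a - b| / (2 * (|a - b| + 1) ^ 2) :=
    div_pos (mul_pos hD (by linarith)) (by positivity)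
  linarith

variable {E : Type*} [Fintype E] {q : ℕ → E → (ℤ → E) → ℝ}

/-- The prediction obtained from `q` by giving the letter `e` the additional factor `1 + t k`, where
`t k` is a function of the past, and normalising. -/
def tiltedWeights [DecidableEq E] (q : ℕ → E → (ℤ → E) → ℝ) (e : E) (t : ℕ → (ℤ → E) → ℝ) (k : ℕ)
    (e' : E) (σ : ℤ → E) : ℝ :=
  q k e' σ * (1 + if e' = e then t k σ else 0) / (1 + q k e σ * t k σ)

theorem abs_mul_le_half {x t : ℝ} (h₀ : 0 ≤ x) (h₁ : x ≤ 1) (ht : |t| ≤ 1 / 2) :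
    |x * t| ≤ 1 / 2 := by
  rw [abs_mul, abs_of_nonneg h₀]
  exact (mul_le_of_le_one_left (abs_nonneg t) h₁).trans ht

theorem IsPastWeights.tilted [DecidableEq E] (hq : IsPastWeights q) (e : E)
    {t : ℕ → (ℤ → E) → ℝ} (hdep : ∀ k, DependsOn (t k) (Set.Icc (-(k : ℤ)) 0))
    (ht : ∀ k σ, |t k σ| ≤ 1 / 2) : IsPastWeights (tiltedWeights q e t) := by
  have hden (k : ℕ) (σ : ℤ → E) : 0 < 1 + q k e σ * t k σ := by
    linarith [(abs_le.1 (abs_mul_le_half (hq.nonneg k e σ) (hq.le_one k e σ) (ht k σ))).1]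
  refine ⟨fun k e' σ τ h => ?_, fun k e' σ => ?_, fun k σ => ?_⟩
  · rw [tiltedWeights, tiltedWeights, hq.dependsOn k e h, hq.dependsOn k e' h, hdep k h]
  · have hfac : 0 ≤ 1 + if e' = e then t k σ else 0 := by
      split_ifs <;> linarith [(abs_le.1 (ht k σ)).1]
    exact div_nonneg (mul_nonneg (hq.nonneg k e' σ) hfac) (hden k σ).le
  · simp only [tiltedWeights, ← Finset.sum_div, mul_add, mul_one, mul_ite, mul_zero,
      Finset.sum_add_distrib, Finset.sum_ite_eq', Finset.mem_univ, if_true]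
    exact (div_le_one (hden k σ)).2 (by linarith [hq.sum_le_one k σ])

theorem IsPastWeights.div_three_le_tilted [DecidableEq E] (hq : IsPastWeights q) {e e' : E}
    {t : ℕ → (ℤ → E) → ℝ} {k : ℕ} {σ : ℤ → E} (ht : |t k σ| ≤ 1 / 2) {c : ℝ} (hc : 0 ≤ c)
    (hle : c ≤ q k e' σ) : c / 3 ≤ tiltedWeights q e t k e' σ := by
  obtain ⟨h₁, h₂⟩ := abs_le.1 (abs_mul_le_half (hq.nonneg k e σ) (hq.le_one k e σ) ht)
  have hfac : 1 / 2 ≤ 1 + if e' = e then t k σ else 0 := by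
    split_ifs <;> linarith [(abs_le.1 ht).1]
  rw [tiltedWeights, div_le_div_iff₀ (by norm_num) (by linarith)]
  have h₃ : c * (1 / 2) ≤ q k e' σ * (1 + if e' = e then t k σ else 0) :=
    mul_le_mul hle hfac (by norm_num) (hc.trans hle)
  have h₄ : c * (1 + q k e σ * t k σ) ≤ c * (3 / 2) := mul_le_mul_of_nonneg_left (by linarith) hc
  linarith

theorem log_add_sub_le_log_tilted {x y t : ℝ} {P : Prop} [Decidable P] (hx : 0 < x) (hy₀ : 0 ≤ y)
    (hy₁ : y ≤ 1) (ht : |t| ≤ 1 / 2) :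
    Real.log x + ((if P then t - 2 * t ^ 2 else 0) - y * t) ≤
      Real.log (x * (1 + if P then t else 0) / (1 + y * t)) := by
  have hden : 0 < 1 + y * t := by linarith [(abs_le.1 (abs_mul_le_half hy₀ hy₁ ht)).1]
  have hfac : 0 < 1 + if P then t else 0 := by split_ifs <;> linarith [(abs_le.1 ht).1]
  rw [Real.log_div (mul_pos hx hfac).ne' hden.ne', Real.log_mul hx.ne' hfac.ne']
  have hnum : (if P then t - 2 * t ^ 2 else 0) ≤ Real.log (1 + if P then t else 0) := by
    split_ifs
    · exact sub_two_mul_sq_le_log ht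
    · simp
  linarith [Real.log_le_sub_one_of_pos hden]

variable [MeasurableSpace E] {Θ : Measure (ℤ → E)} {r : E → (ℤ → E) → ℝ} {c : ℝ}

theorem IsPastWeights.ae_lim_mem_Icc (hq : IsPastWeights q) {e : E}
    (hlim : ∀ᵐ σ ∂Θ, Tendsto (fun k => q k e σ) atTop (𝓝 (r e σ))) :
    ∀ᵐ σ ∂Θ, r e σ ∈ Set.Icc (0 : ℝ) 1 :=
  hlim.mono fun σ h => isClosed_Icc.mem_of_tendsto h
    (Eventually.of_forall fun k => ⟨hq.nonneg k e σ, hq.le_one k e σ⟩)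

/-- The limit of the probability of the next letter under the tilted prediction, if the original
prediction converges to `r` and the tilt is eventually `T`. -/
def tiltedLim [DecidableEq E] (r : E → (ℤ → E) → ℝ) (e : E) (T : (ℤ → E) → ℝ) (σ : ℤ → E) : ℝ :=
  r (σ 1) σ * (1 + if σ 1 = e then T σ else 0) / (1 + r e σ * T σ)

theorem exists_tendsto_tiltedLim [DecidableEq E] (hq : IsPastWeights q) (hc : 0 ≤ c)
    (hlow : ∀ᵐ σ ∂Θ, ∀ k, c ≤ q k (σ 1) σ)
    (hlim : ∀ e, ∀ᵐ σ ∂Θ, Tendsto (fun k => q k e σ) atTop (𝓝 (r e σ))) (e : E)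
    {T : (ℤ → E) → ℝ} {N : ℕ} (hdep : DependsOn T (Set.Icc (-(N : ℤ)) 0))
    (hT : ∀ σ, |T σ| ≤ 1 / 2) :
    ∃ q', IsPastWeights q' ∧ (∀ᵐ σ ∂Θ, ∀ k, c / 3 ≤ q' k (σ 1) σ) ∧
      ∀ᵐ σ ∂Θ, Tendsto (fun k => q' k (σ 1) σ) atTop (𝓝 (tiltedLim r e T σ)) := by
  let t (k : ℕ) (σ : ℤ → E) : ℝ := if N ≤ k then T σ else 0
  have htdep (k : ℕ) : DependsOn (t k) (Set.Icc (-(k : ℤ)) 0) := fun σ τ h => by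
    by_cases hk : N ≤ k
    · simpa only [t, if_pos hk] using hdep fun j hj => h j ⟨by grind, hj.2⟩
    · simp only [t, if_neg hk]
  have ht (k : ℕ) (σ : ℤ → E) : |t k σ| ≤ 1 / 2 := by
    by_cases hk : N ≤ k
    · simpa only [t, if_pos hk] using hT σ
    · simp [t, if_neg hk]
  refine ⟨tiltedWeights q e t, hq.tilted e htdep ht,
    hlow.mono fun σ h k => hq.div_three_le_tilted (ht k σ) hc (h k), ?_⟩
  filter_upwards [ae_all_iff.2 hlim, hq.ae_lim_mem_Icc (hlim e)] with σ h hre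
  have hden := (abs_le.1 (abs_mul_le_half hre.1 hre.2 (hT σ))).1
  have heq : ∀ᶠ k in atTop, q k (σ 1) σ * (1 + if σ 1 = e then T σ else 0) /
      (1 + q k e σ * T σ) = tiltedWeights q e t k (σ 1) σ := by
    filter_upwards [eventually_ge_atTop N] with k hk
    simp only [tiltedWeights, t, if_pos hk]
  exact (((h (σ 1)).mul_const _).div (((h e).mul_const _).const_add 1) (by linarith)).congr' heq

variable [DiscreteMeasurableSpace E]

theorem IsPastWeights.aemeasurable_lim (hq : IsPastWeights q) {e : E}
    (hlim : ∀ᵐ σ ∂Θ, Tendsto (fun k => q k e σ) atTop (𝓝 (r e σ))) : AEMeasurable (r e) Θ :=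
  aemeasurable_of_tendsto_metrizable_ae' (fun k => (measurable_of_dependsOn_Icc
    (hq.dependsOn k e)).aemeasurable) hlim

variable [IsProbabilityMeasure Θ]

theorem integrable_log_lim (hq : IsPastWeights q) (hc : 0 < c)
    (hlow : ∀ᵐ σ ∂Θ, ∀ k, c ≤ q k (σ 1) σ) {g : (ℤ → E) → ℝ}
    (hlim : ∀ᵐ σ ∂Θ, Tendsto (fun k => q k (σ 1) σ) atTop (𝓝 (g σ))) :
    Integrable (fun σ => Real.log (g σ)) Θ := by
  have hmeas : AEMeasurable g Θ := aemeasurable_of_tendsto_metrizable_ae'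
    (fun k => (measurable_of_dependsOn_Icc (hq.dependsOn_next k)).aemeasurable) hlim
  refine Integrable.of_bound
    (Real.measurable_log.comp_aemeasurable hmeas).aestronglyMeasurable (-Real.log c) ?_
  filter_upwards [hlow, hlim] with σ h₁ h₂
  have hge : c ≤ g σ := ge_of_tendsto' h₂ h₁
  rw [Real.norm_eq_abs, abs_of_nonpos (Real.log_nonpos (hc.le.trans hge)
    (le_of_tendsto' h₂ fun k => hq.le_one k _ σ))]
  exact neg_le_neg (Real.log_le_log hc hge)

-- The entropy bound given by the tilted prediction cannot be better than the one given by `q`.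
theorem setIntegral_sub_le_of_le_ksEntropy (hΘ : MeasurePreserving leftShift Θ Θ)
    (hq : IsPastWeights q) (hc : 0 < c) (hlow : ∀ᵐ σ ∂Θ, ∀ k, c ≤ q k (σ 1) σ)
    (hlim : ∀ e, ∀ᵐ σ ∂Θ, Tendsto (fun k => q k e σ) atTop (𝓝 (r e σ)))
    (hle : ((-∫ σ, Real.log (r (σ 1) σ) ∂Θ : ℝ) : EReal) ≤ ksEntropy Θ leftShift) (e : E)
    {T : (ℤ → E) → ℝ} {N : ℕ} (hdep : DependsOn T (Set.Icc (-(N : ℤ)) 0))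
    (hT : ∀ σ, |T σ| ≤ 1 / 2) :
    ∫ σ in {σ | σ 1 = e}, (T σ - 2 * T σ ^ 2) ∂Θ ≤ ∫ σ, r e σ * T σ ∂Θ := by
  classical
  have hlim' : ∀ᵐ σ ∂Θ, Tendsto (fun k => q k (σ 1) σ) atTop (𝓝 (r (σ 1) σ)) :=
    (ae_all_iff.2 hlim).mono fun σ h => h (σ 1)
  obtain ⟨q', hq', hlow', htilt⟩ := exists_tendsto_tiltedLim hq hc.le hlow hlim e hdep hT
  have hbound : ∫ σ, Real.log (tiltedLim r e T σ) ∂Θ ≤ ∫ σ, Real.log (r (σ 1) σ) ∂Θ := by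
    have := hle.trans (ksEntropy_leftShift_le hΘ hq' (by positivity) hlow' htilt)
    linarith [EReal.coe_le_coe_iff.1 this]
  have hlog := integrable_log_lim hq hc hlow hlim'
  have hletter := measurableSet_eq_letter (1 : ℤ) e
  have hgain : Integrable ({σ | σ 1 = e}.indicator fun σ => T σ - 2 * T σ ^ 2) Θ :=
    (integrable_of_dependsOn_Icc (a := -(N : ℤ)) (b := 0) fun _ _ h => by
      simp only [hdep h]).indicator hletter
  have hloss : Integrable (fun σ => r e σ * T σ) Θ :=
    (integrable_of_dependsOn_Icc hdep).bdd_mul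
      (hq.aemeasurable_lim (hlim e)).aestronglyMeasurable
      ((hq.ae_lim_mem_Icc (hlim e)).mono fun σ h => by
        rw [Real.norm_eq_abs, abs_of_nonneg h.1]; exact h.2)
  have hdiff : Integrable (fun σ => {σ | σ 1 = e}.indicator (fun σ => T σ - 2 * T σ ^ 2) σ -
      r e σ * T σ) Θ := hgain.sub hloss
  have hint : ∫ σ, (Real.log (r (σ 1) σ) +
      ({σ | σ 1 = e}.indicator (fun σ => T σ - 2 * T σ ^ 2) σ - r e σ * T σ)) ∂Θ ≤
        ∫ σ, Real.log (tiltedLim r e T σ) ∂Θ := by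
    refine integral_mono_ae (hlog.add hdiff)
      (integrable_log_lim hq' (by positivity) hlow' htilt) ?_
    filter_upwards [hlow, hlim', hq.ae_lim_mem_Icc (hlim e)] with σ h₁ h₂ hre
    exact log_add_sub_le_log_tilted (hc.trans_le (ge_of_tendsto' h₂ h₁)) hre.1 hre.2 (hT σ)
  rw [integral_add hlog hdiff, integral_sub hgain hloss,
    integral_indicator hletter] at hint
  linarith

theorem measureReal_restrict_letter_of_le_ksEntropy (hΘ : MeasurePreserving leftShift Θ Θ)
    (hq : IsPastWeights q) (hc : 0 < c) (hlow : ∀ᵐ σ ∂Θ, ∀ k, c ≤ q k (σ 1) σ)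
    (hlim : ∀ e, ∀ᵐ σ ∂Θ, Tendsto (fun k => q k e σ) atTop (𝓝 (r e σ)))
    (hle : ((-∫ σ, Real.log (r (σ 1) σ) ∂Θ : ℝ) : EReal) ≤ ksEntropy Θ leftShift) (e : E)
    {A : Set (ℤ → E)} {N : ℕ} (hA : DependsOn (fun σ => σ ∈ A) (Set.Icc (-(N : ℤ)) 0)) :
    (Θ.restrict {σ | σ 1 = e}).real A = ∫ σ in A, r e σ ∂Θ := by
  classical
  have hAm : MeasurableSet A := measurableSet_setOfPred.2 (measurable_of_dependsOn_Icc hA)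
  refine eq_of_forall_mul_sub_sq_le fun s hs => ?_
  have hdep : DependsOn (A.indicator fun _ => s) (Set.Icc (-(N : ℤ)) 0) := fun σ τ h => by
    simp only [Set.indicator_apply, hA h]
  have hT (σ : ℤ → E) : |A.indicator (fun _ => s) σ| ≤ 1 / 2 := by
    rw [Set.indicator_apply]
    split_ifs
    exacts [hs, by norm_num]
  have hsq (σ : ℤ → E) : A.indicator (fun _ => s) σ - 2 * A.indicator (fun _ => s) σ ^ 2 =
      A.indicator (fun _ => s - 2 * s ^ 2) σ := by
    simp only [Set.indicator_apply]
    split_ifs <;> simp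
  have hmul (σ : ℤ → E) : r e σ * A.indicator (fun _ => s) σ =
      A.indicator (fun σ => s * r e σ) σ := by
    simp only [Set.indicator_apply]
    split_ifs <;> ring
  have hle := setIntegral_sub_le_of_le_ksEntropy hΘ hq hc hlow hlim hle e hdep hT
  simp only [hsq, hmul, integral_indicator hAm, setIntegral_const, smul_eq_mul,
    integral_const_mul] at hle
  have : s ^ 2 * (Θ.restrict {σ | σ 1 = e}).real A ≤ s ^ 2 :=
    mul_le_of_le_one_right (sq_nonneg s)
      ((measureReal_restrict_apply hAm).trans_le measureReal_le_one)
  linarith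

/-- The conditional probability of the letter `e` at time `1` given the past up to time `0` is
`r e`, in the form of its defining property. -/
def HasTransitionProb (Θ : Measure (ℤ → E)) (r : E → (ℤ → E) → ℝ) : Prop :=
  ∀ (e : E) (h : (ℤ → E) → ℝ), Measurable h → DependsOn h (Set.Iic 0) →
    ∫ σ in {σ | σ 1 = e}, h σ ∂Θ = ∫ σ, r e σ * h σ ∂Θ

theorem hasTransitionProb_of_le_ksEntropy (hΘ : MeasurePreserving leftShift Θ Θ)
    (hq : IsPastWeights q) (hc : 0 < c) (hlow : ∀ᵐ σ ∂Θ, ∀ k, c ≤ q k (σ 1) σ)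
    (hlim : ∀ e, ∀ᵐ σ ∂Θ, Tendsto (fun k => q k e σ) atTop (𝓝 (r e σ)))
    (hle : ((-∫ σ, Real.log (r (σ 1) σ) ∂Θ : ℝ) : EReal) ≤ ksEntropy Θ leftShift) :
    HasTransitionProb Θ r := by
  intro e h hh hdep
  have hr := hq.aemeasurable_lim (hlim e)
  have hr_mem := hq.ae_lim_mem_Icc (hlim e)
  have hr_int : Integrable (r e) Θ := Integrable.of_mem_Icc 0 1 hr hr_mem
  have hpast (N : ℕ) (A : Set (ℤ → E)) (hA : DependsOn (fun σ => σ ∈ A) (Set.Icc (-(N : ℤ)) 0)) :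
      Θ.restrict {σ | σ 1 = e} A = Θ.withDensity (fun σ => ENNReal.ofReal (r e σ)) A := by
    have hAm : MeasurableSet A := measurableSet_setOfPred.2 (measurable_of_dependsOn_Icc hA)
    rw [withDensity_apply _ hAm, ← ofReal_integral_eq_lintegral_ofReal hr_int.restrict
      (ae_restrict_of_ae (hr_mem.mono fun _ h => h.1)),
      ← measureReal_restrict_letter_of_le_ksEntropy hΘ hq hc hlow hlim hle e hA,
      ofReal_measureReal]
  rw [integral_eq_integral_of_forall_past hpast hh hdep,
    integral_withDensity_eq_integral_toReal_smul₀ hr.ennreal_ofReal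
      (ae_of_all _ fun _ => ENNReal.ofReal_lt_top)]
  exact integral_congr_ae (hr_mem.mono fun σ hσ => by
    simp only [ENNReal.toReal_ofReal hσ.1, smul_eq_mul])

end EqualityCase

namespace MarkovSystem

/-! ### Vertex sets, probability functions and words -/

section Basic

variable {K V E : Type*} [MeasurableSpace K] [Fintype E] (𝓜 : MarkovSystem K V E)

theorem exists_mem_vset (y : K) : ∃ i, y ∈ 𝓜.vset i :=
  Set.iUnion_eq_univ_iff.1 𝓜.vset_cover y

theorem vset_eq_of_mem {y : K} {i j : V} (hi : y ∈ 𝓜.vset i) (hj : y ∈ 𝓜.vset j) : i = j := by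
  by_contra h
  exact Set.disjoint_left.1 (𝓜.vset_disjoint h) hi hj

theorem mem_vset_of_p_ne_zero {e : E} {y : K} (h : 𝓜.p e y ≠ 0) : y ∈ 𝓜.vset (𝓜.init e) :=
  not_imp_comm.1 (𝓜.p_zero e y) h

theorem indicator_p (e : E) : (𝓜.vset (𝓜.init e)).indicator (𝓜.p e) = 𝓜.p e :=
  Set.indicator_eq_self.2 fun _ hy => 𝓜.mem_vset_of_p_ne_zero hy

theorem log_p_nonpos (e : E) (y : K) : Real.log (𝓜.p e y) ≤ 0 :=
  Real.log_nonpos (𝓜.p_nonneg e y) (𝓜.p_le_one e y)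

-- `Real.log 0 = 0`, so that the bound extends to the points off `K_{i(e)}`.
theorem abs_log_p_le {δ : ℝ} (hδ : 0 < δ) (hp : ∀ e, ∀ y ∈ 𝓜.vset (𝓜.init e), δ ≤ 𝓜.p e y)
    (e : E) (y : K) : |Real.log (𝓜.p e y)| ≤ |Real.log δ| := by
  by_cases hy : y ∈ 𝓜.vset (𝓜.init e)
  · have hlog := Real.log_le_log hδ (hp e y hy)
    rw [abs_of_nonpos (𝓜.log_p_nonpos e y), abs_of_nonpos (hlog.trans (𝓜.log_p_nonpos e y))]
    exact neg_le_neg hlog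
  · simp [𝓜.p_zero e y hy]

theorem measurable_markovOp {f : K → ℝ} (hf : Measurable f) : Measurable (𝓜.markovOp f) :=
  Finset.measurable_sum _ fun e _ => (𝓜.p_measurable e).mul (hf.comp (𝓜.w_measurable e))

theorem abs_markovOp_le {f : K → ℝ} {C : ℝ} (hf : ∀ y, |f y| ≤ C) (y : K) :
    |𝓜.markovOp f y| ≤ C := by
  calc |𝓜.markovOp f y| ≤ ∑ e, |𝓜.p e y * f (𝓜.w e y)| := Finset.abs_sum_le_sum_abs _ _
    _ ≤ ∑ e, 𝓜.p e y * C := Finset.sum_le_sum fun e _ => by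
        rw [abs_mul, abs_of_nonneg (𝓜.p_nonneg e y)]
        exact mul_le_mul_of_nonneg_left (hf _) (𝓜.p_nonneg e y)
    _ = C := by rw [← Finset.sum_mul, 𝓜.p_sum, one_mul]

theorem measurable_markovOp_iterate {f : K → ℝ} (hf : Measurable f) (n : ℕ) :
    Measurable (𝓜.markovOp^[n] f) := by
  induction n with
  | zero => exact hf
  | succ n ih =>
    rw [Function.iterate_succ_apply']
    exact 𝓜.measurable_markovOp ih

theorem abs_markovOp_iterate_le {f : K → ℝ} {C : ℝ} (hf : ∀ y, |f y| ≤ C) (n : ℕ) (y : K) :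
    |𝓜.markovOp^[n] f y| ≤ C := by
  induction n generalizing y with
  | zero => exact hf y
  | succ n ih =>
    rw [Function.iterate_succ_apply']
    exact 𝓜.abs_markovOp_le ih y

variable {𝓜} in
theorem IsInvariant.integral_markovOp_iterate {μ : Measure K} (hμ : 𝓜.IsInvariant μ) {f : K → ℝ}
    (hf : Measurable f) {C : ℝ} (hC : ∀ y, |f y| ≤ C) (n : ℕ) :
    ∫ y, 𝓜.markovOp^[n] f y ∂μ = ∫ y, f y ∂μ := by
  induction n with
  | zero => rfl
  | succ n ih =>
    rw [Function.iterate_succ_apply', ← ih]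
    exact hμ.2 _ (𝓜.measurable_markovOp_iterate hf n) ⟨C, 𝓜.abs_markovOp_iterate_le hC n⟩

theorem abs_pathProb_le_one (l : List E) (y : K) : |𝓜.pathProb l y| ≤ 1 := by
  rw [abs_of_nonneg (𝓜.pathProb_nonneg l y)]
  exact 𝓜.pathProb_le_one l y

theorem integrable_pathProb (μ : Measure K) [IsFiniteMeasure μ] (l : List E) :
    Integrable (𝓜.pathProb l) μ :=
  .of_bound (𝓜.pathProb_measurable l).aestronglyMeasurable 1
    (Eventually.of_forall (𝓜.abs_pathProb_le_one l))

theorem init_eq_of_pathProb_ne_zero {n : ℕ} {v : Fin (n + 1) → E} {y : K} {i : V}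
    (h : 𝓜.pathProb (List.ofFn v) y ≠ 0) (hy : y ∈ 𝓜.vset i) : 𝓜.init (v 0) = i := by
  rw [List.ofFn_succ, pathProb] at h
  exact 𝓜.vset_eq_of_mem (𝓜.mem_vset_of_p_ne_zero (left_ne_zero_of_mul h)) hy

/-- The map `w_{eₖ} ∘ ⋯ ∘ w_{e₁}` of the word `e₁ … eₖ`: the place that is reached by following the
word. -/
def wordMap (l : List E) (y : K) : K := l.foldl (fun z e => 𝓜.w e z) y

theorem wordMap_cons (e : E) (l : List E) (y : K) :
    𝓜.wordMap (e :: l) y = 𝓜.wordMap l (𝓜.w e y) := rfl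

theorem measurable_wordMap (l : List E) : Measurable (𝓜.wordMap l) := by
  induction l with
  | nil => exact measurable_id
  | cons e l ih => exact ih.comp (𝓜.w_measurable e)

theorem pathProb_append_singleton (l : List E) (e : E) (y : K) :
    𝓜.pathProb (l ++ [e]) y = 𝓜.pathProb l y * 𝓜.p e (𝓜.wordMap l y) := by
  induction l generalizing y with
  | nil => simp [pathProb, wordMap]
  | cons a l ih => rw [List.cons_append, pathProb, ih, pathProb, wordMap_cons, mul_assoc]

theorem sum_pathProb_succ (n : ℕ) (y : K) (Φ : List E → ℝ) :
    ∑ v : Fin (n + 1) → E, 𝓜.pathProb (List.ofFn v) y * Φ (List.ofFn v) =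
      ∑ e, 𝓜.p e y *
        ∑ v : Fin n → E, 𝓜.pathProb (List.ofFn v) (𝓜.w e y) * Φ (e :: List.ofFn v) := by
  rw [← (Fin.consEquiv fun _ : Fin (n + 1) => E).sum_comp, Fintype.sum_prod_type]
  refine Finset.sum_congr rfl fun e _ => ?_
  rw [Finset.mul_sum]
  refine Finset.sum_congr rfl fun v _ => ?_
  simp only [Fin.consEquiv, Equiv.coe_fn_mk, List.ofFn_cons, pathProb, mul_assoc]

theorem sum_pathProb_mul_wordMap (f : K → ℝ) (n : ℕ) (y : K) :
    ∑ v : Fin n → E, 𝓜.pathProb (List.ofFn v) y * f (𝓜.wordMap (List.ofFn v) y) =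
      𝓜.markovOp^[n] f y := by
  induction n generalizing y with
  | zero => simp [pathProb, wordMap]
  | succ n ih =>
    rw [𝓜.sum_pathProb_succ n y fun l => f (𝓜.wordMap l y), Function.iterate_succ_apply', markovOp]
    simp only [wordMap_cons, ih]

theorem sum_pathProb (n : ℕ) (y : K) : ∑ v : Fin n → E, 𝓜.pathProb (List.ofFn v) y = 1 := by
  have hone : 𝓜.markovOp (fun _ => 1) = fun _ => 1 := by
    funext z
    simp [markovOp, 𝓜.p_sum]
  have := 𝓜.sum_pathProb_mul_wordMap (fun _ => 1) n y
  rwa [Function.iterate_fixed hone, Finset.sum_congr rfl fun v _ => mul_one _] at this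

theorem backComp_eq_wordMap (σ : ℤ → E) (k : ℕ) (y : K) :
    𝓜.backComp σ k y = 𝓜.wordMap (List.ofFn (wordAt (-(k : ℤ)) (k + 1) σ)) y := by
  induction k generalizing y with
  | zero => simp [wordAt, wordMap, backComp]
  | succ k ih =>
    have hcons : List.ofFn (wordAt (-((k + 1 : ℕ) : ℤ)) (k + 1 + 1) σ) =
        σ (-((k : ℤ) + 1)) :: List.ofFn (wordAt (-(k : ℤ)) (k + 1) σ) := by
      rw [List.ofFn_succ]
      refine congrArg₂ List.cons (by simp [wordAt]) (congrArg List.ofFn (funext fun j => ?_))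
      simp only [wordAt, Fin.val_succ]
      congr 1
      push_cast
      ring
    rw [hcons, wordMap_cons, ← ih, backComp]

end Basic

section Continuity

variable {K V E : Type*} [MeasurableSpace K] [Fintype E] {𝓜 : MarkovSystem K V E}

theorem isClosed_vset [TopologicalSpace K] (hopen : ∀ i, IsOpen (𝓜.vset i)) (i : V) :
    IsClosed (𝓜.vset i) := by
  have hcompl : (𝓜.vset i)ᶜ = ⋃ j ∈ {j | j ≠ i}, 𝓜.vset j := by
    ext y
    simp only [Set.mem_compl_iff, Set.mem_iUnion, Set.mem_ofPred_eq, exists_prop]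
    constructor
    · intro hy
      obtain ⟨j, hj⟩ := 𝓜.exists_mem_vset y
      exact ⟨j, fun h => hy (h ▸ hj), hj⟩
    · rintro ⟨j, hne, hj⟩ hi
      exact hne (𝓜.vset_eq_of_mem hj hi)
  rw [← isOpen_compl_iff, hcompl]
  exact isOpen_biUnion fun j _ => hopen j

theorem continuous_p [TopologicalSpace K] (hopen : ∀ i, IsOpen (𝓜.vset i)) {e : E}
    (hcont : ContinuousOn (𝓜.p e) (𝓜.vset (𝓜.init e))) : Continuous (𝓜.p e) := by
  have hclosed := isClosed_vset hopen (𝓜.init e)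
  rw [← 𝓜.indicator_p e]
  refine continuous_indicator (fun y hy => ?_) (by rwa [hclosed.closure_eq])
  rw [IsClopen.frontier_eq ⟨hclosed, hopen _⟩] at hy
  exact hy.elim

variable [MetricSpace K]

theorem continuousOn_w (hcontr : 𝓜.IsContractive) {δ : ℝ} (hδ : 0 < δ) {e : E}
    (hp : ∀ y ∈ 𝓜.vset (𝓜.init e), δ ≤ 𝓜.p e y) :
    ContinuousOn (𝓜.w e) (𝓜.vset (𝓜.init e)) := by
  obtain ⟨a, ha0, -, ha⟩ := hcontr
  refine (LipschitzOnWith.of_dist_le_mul (K := (a / δ).toNNReal) fun y hy z hz => ?_).continuousOn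
  rw [Real.coe_toNNReal _ (by positivity), div_mul_eq_mul_div, le_div_iff₀' hδ]
  calc δ * dist (𝓜.w e y) (𝓜.w e z) ≤ 𝓜.p e y * dist (𝓜.w e y) (𝓜.w e z) :=
        mul_le_mul_of_nonneg_right (hp y hy) dist_nonneg
    _ ≤ ∑ e, 𝓜.p e y * dist (𝓜.w e y) (𝓜.w e z) :=
        Finset.single_le_sum (f := fun e => 𝓜.p e y * dist (𝓜.w e y) (𝓜.w e z))
          (fun e _ => mul_nonneg (𝓜.p_nonneg e y) dist_nonneg) (Finset.mem_univ e)
    _ ≤ a * dist y z := ha _ y hy z hz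

theorem sum_pathProb_mul_dist_wordMap_le {a : ℝ} (ha0 : 0 ≤ a)
    (ha : ∀ i, ∀ y ∈ 𝓜.vset i, ∀ z ∈ 𝓜.vset i,
      ∑ e, 𝓜.p e y * dist (𝓜.w e y) (𝓜.w e z) ≤ a * dist y z)
    (n : ℕ) {i : V} {y z : K} (hy : y ∈ 𝓜.vset i) (hz : z ∈ 𝓜.vset i) :
    ∑ v : Fin n → E, 𝓜.pathProb (List.ofFn v) y *
      dist (𝓜.wordMap (List.ofFn v) y) (𝓜.wordMap (List.ofFn v) z) ≤ a ^ n * dist y z := by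
  induction n generalizing i y z with
  | zero => simp [pathProb, wordMap]
  | succ n ih =>
    rw [𝓜.sum_pathProb_succ n y fun l => dist (𝓜.wordMap l y) (𝓜.wordMap l z)]
    simp only [wordMap_cons]
    calc _ ≤ ∑ e, 𝓜.p e y * (a ^ n * dist (𝓜.w e y) (𝓜.w e z)) := by
          refine Finset.sum_le_sum fun e _ => ?_
          rcases eq_or_ne (𝓜.p e y) 0 with h0 | h0
          · simp [h0]
          · obtain rfl := 𝓜.vset_eq_of_mem hy (𝓜.mem_vset_of_p_ne_zero h0)
            exact mul_le_mul_of_nonneg_left (ih (𝓜.w_mapsTo e hy) (𝓜.w_mapsTo e hz))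
              (𝓜.p_nonneg e y)
      _ = a ^ n * ∑ e, 𝓜.p e y * dist (𝓜.w e y) (𝓜.w e z) := by
          rw [Finset.mul_sum]
          exact Finset.sum_congr rfl fun e _ => mul_left_comm _ _ _
      _ ≤ a ^ n * (a * dist y z) :=
          mul_le_mul_of_nonneg_left (ha i y hy z hz) (pow_nonneg ha0 n)
      _ = a ^ (n + 1) * dist y z := by rw [pow_succ, mul_assoc]

end Continuity

/-! ### The coding map -/

section Coding

variable {K V E : Type*} [MeasurableSpace K] [Fintype E] {𝓜 : MarkovSystem K V E}

theorem dependsOn_backPoint (x : V → K) (k : ℕ) :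
    DependsOn (fun σ => 𝓜.backPoint x σ k) (Set.Icc (-(k : ℤ)) 0) := by
  intro σ τ h
  have hword : wordAt (-(k : ℤ)) (k + 1) σ = wordAt (-(k : ℤ)) (k + 1) τ :=
    funext fun j => h _ ⟨by omega, by omega⟩
  simp only [backPoint, backComp_eq_wordMap, hword, h (-(k : ℤ)) ⟨le_rfl, by omega⟩]

theorem backComp_mem {σ : ℤ → E} (hσ : σ ∈ 𝓜.pathSpace) (k : ℕ) {y : K}
    (hy : y ∈ 𝓜.vset (𝓜.init (σ (-(k : ℤ))))) : 𝓜.backComp σ k y ∈ 𝓜.vset (𝓜.init (σ 1)) := by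
  induction k generalizing y with
  | zero =>
    have := 𝓜.w_mapsTo (σ 0) (by simpa using hy)
    rwa [hσ 0] at this
  | succ k ih =>
    refine ih ?_
    have := 𝓜.w_mapsTo (σ (-((k : ℤ) + 1))) (by simpa using hy)
    rw [hσ] at this
    convert this using 4
    ring

theorem backPoint_mem {x : V → K} (hx : ∀ i, x i ∈ 𝓜.vset i) {σ : ℤ → E} (hσ : σ ∈ 𝓜.pathSpace)
    (k : ℕ) : 𝓜.backPoint x σ k ∈ 𝓜.vset (𝓜.init (σ 1)) :=
  backComp_mem hσ k (hx _)

theorem backComp_leftShift (σ : ℤ → E) (k : ℕ) (y : K) :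
    𝓜.backComp (leftShift σ) (k + 1) y = 𝓜.w (σ 1) (𝓜.backComp σ k y) := by
  induction k generalizing y with
  | zero => simp [backComp, leftShift, shiftBy]
  | succ k ih =>
    rw [backComp, ih, backComp]
    congr 3

theorem backPoint_leftShift (x : V → K) (σ : ℤ → E) (k : ℕ) :
    𝓜.backPoint x (leftShift σ) (k + 1) = 𝓜.w (σ 1) (𝓜.backPoint x σ k) := by
  rw [backPoint, backComp_leftShift, backPoint]
  congr 4
  simp only [leftShift, shiftBy]
  congr 1
  push_cast
  ring

theorem measurable_backPoint [MeasurableSpace E] [DiscreteMeasurableSpace E] (x : V → K) (k : ℕ) :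
    Measurable fun σ => 𝓜.backPoint x σ k :=
  measurable_of_dependsOn_Icc (dependsOn_backPoint x k)

section Topological

variable [TopologicalSpace K] {x : V → K} {σ : ℤ → E}

theorem mem_codingDomain_iff : σ ∈ 𝓜.codingDomain x ↔ ∀ j : ℤ, shiftBy j σ ∈ 𝓜.limitSet x := by
  simp only [codingDomain, Set.mem_iInter]
  constructor
  · intro h j
    obtain ⟨τ, hτ, rfl⟩ := h (-j)
    rwa [shiftBy_shiftBy, add_neg_cancel, shiftBy_zero]
  · intro h j
    exact ⟨shiftBy (-j) σ, h (-j), by rw [shiftBy_shiftBy, add_neg_cancel, shiftBy_zero]⟩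

theorem mem_limitSet_of_mem_codingDomain (h : σ ∈ 𝓜.codingDomain x) : σ ∈ 𝓜.limitSet x := by
  simpa [shiftBy_zero] using mem_codingDomain_iff.1 h 0

theorem tendsto_backPoint (h : σ ∈ 𝓜.limitSet x) :
    Tendsto (𝓜.backPoint x σ) atTop (𝓝 (𝓜.codingMap x σ)) := by
  rw [codingMap, dif_pos h.2]
  exact h.2.choose_spec

theorem dependsOn_codingMap (x : V → K) : DependsOn (𝓜.codingMap x) (Set.Iic 0) := by
  intro σ τ h
  have hback : 𝓜.backPoint x σ = 𝓜.backPoint x τ :=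
    funext fun k => dependsOn_backPoint x k fun j hj => h j hj.2
  rw [codingMap, codingMap, hback, h 0 (Set.mem_Iic.2 le_rfl)]

theorem codingMap_mem (hopen : ∀ i, IsOpen (𝓜.vset i)) (hx : ∀ i, x i ∈ 𝓜.vset i)
    (h : σ ∈ 𝓜.codingDomain x) : 𝓜.codingMap x σ ∈ 𝓜.vset (𝓜.init (σ 1)) :=
  have hl := mem_limitSet_of_mem_codingDomain h
  (isClosed_vset hopen _).mem_of_tendsto (tendsto_backPoint hl)
    (Eventually.of_forall (backPoint_mem hx hl.1))

theorem codingMap_leftShift [T2Space K] (hopen : ∀ i, IsOpen (𝓜.vset i))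
    (hw : ∀ e, ContinuousOn (𝓜.w e) (𝓜.vset (𝓜.init e))) (hx : ∀ i, x i ∈ 𝓜.vset i)
    (h : σ ∈ 𝓜.codingDomain x) :
    𝓜.codingMap x (leftShift σ) = 𝓜.w (σ 1) (𝓜.codingMap x σ) := by
  have hl := mem_limitSet_of_mem_codingDomain h
  have hshift := (tendsto_add_atTop_iff_nat 1).2 (tendsto_backPoint (mem_codingDomain_iff.1 h 1))
  have himage := (hw (σ 1) _ (codingMap_mem hopen hx h)).tendsto.comp
    (tendsto_nhdsWithin_iff.2 ⟨tendsto_backPoint hl,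
      Eventually.of_forall (backPoint_mem hx hl.1)⟩)
  exact tendsto_nhds_unique hshift (himage.congr fun k => (backPoint_leftShift x σ k).symm)

end Topological

section Measurability

variable [TopologicalSpace K] [PolishSpace K] [BorelSpace K] [MeasurableSpace E]
  [DiscreteMeasurableSpace E] (x : V → K)

theorem measurableSet_exists_tendsto_backPoint :
    MeasurableSet {σ | ∃ y : K, Tendsto (𝓜.backPoint x σ) atTop (𝓝 y)} :=
  measurableSet_exists_tendsto (f := fun k σ => 𝓜.backPoint x σ k) (measurable_backPoint x)

theorem measurable_codingMap : Measurable (𝓜.codingMap x) := by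
  classical
  have hinit : Measurable fun σ : ℤ → E => x (𝓜.init (σ 0)) :=
    (Measurable.of_discrete (f := fun e => x (𝓜.init e))).comp (measurable_pi_apply 0)
  refine measurable_of_tendsto_metrizable (f := fun k σ =>
    if ∃ y : K, Tendsto (𝓜.backPoint x σ) atTop (𝓝 y) then 𝓜.backPoint x σ k
      else x (𝓜.init (σ 0)))
    (fun k => (measurable_backPoint x k).ite (measurableSet_exists_tendsto_backPoint x) hinit) ?_
  refine tendsto_pi_nhds.2 fun σ => ?_
  by_cases h : ∃ y : K, Tendsto (𝓜.backPoint x σ) atTop (𝓝 y)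
  · simp only [if_pos h]
    rw [codingMap, dif_pos h]
    exact h.choose_spec
  · simp only [if_neg h]
    rw [codingMap, dif_neg h]
    exact tendsto_const_nhds

theorem measurableSet_limitSet : MeasurableSet (𝓜.limitSet x) := by
  refine MeasurableSet.inter ?_ (measurableSet_exists_tendsto_backPoint x)
  simp only [pathSpace, Set.ofPred_forall]
  have hpair : ∀ j : ℤ, Measurable fun σ : ℤ → E => (σ j, σ (j + 1)) := fun j =>
    (measurable_pi_apply j).prodMk (measurable_pi_apply (j + 1))
  exact MeasurableSet.iInter fun j => hpair j (MeasurableSet.of_discrete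
    (s := {q : E × E | 𝓜.term q.1 = 𝓜.init q.2}))

theorem measurableSet_codingDomain : MeasurableSet (𝓜.codingDomain x) := by
  have hpreimage : 𝓜.codingDomain x = ⋂ j : ℤ, shiftBy j ⁻¹' 𝓜.limitSet x := by
    ext σ
    simp [mem_codingDomain_iff]
  rw [hpreimage]
  exact MeasurableSet.iInter fun j => measurable_shiftBy j (measurableSet_limitSet x)

theorem measurable_apply_codingMap {φ : E → K → ℝ} (hφ : ∀ e, Measurable (φ e)) :
    Measurable fun σ : ℤ → E => φ (σ 1) (𝓜.codingMap x σ) :=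
  (measurable_from_prod_countable_right (f := fun q : E × K => φ q.1 q.2) hφ).comp
    ((measurable_pi_apply 1).prodMk (measurable_codingMap x))

theorem measurable_log_p_codingMap :
    Measurable fun σ : ℤ → E => Real.log (𝓜.p (σ 1) (𝓜.codingMap x σ)) :=
  measurable_apply_codingMap x fun e => Real.measurable_log.comp (𝓜.p_measurable e)

theorem isEnergyFunction_energy : IsEnergyFunction (𝓜.energy x) := by
  classical
  refine ⟨Measurable.ite (measurableSet_codingDomain x)
    (measurable_coe_real_ereal.comp (measurable_log_p_codingMap x)) measurable_const, fun σ => ?_⟩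
  rw [energy]
  split_ifs
  · exact_mod_cast 𝓜.log_p_nonpos _ _
  · exact bot_le

variable {x} {Θ : Measure (ℤ → E)}

theorem integrable_log_p_codingMap [IsFiniteMeasure Θ] {δ : ℝ} (hδ : 0 < δ)
    (hp : ∀ e, ∀ y ∈ 𝓜.vset (𝓜.init e), δ ≤ 𝓜.p e y) :
    Integrable (fun σ => Real.log (𝓜.p (σ 1) (𝓜.codingMap x σ))) Θ :=
  .of_bound (measurable_log_p_codingMap x).aestronglyMeasurable |Real.log δ|
    (Eventually.of_forall fun _ => 𝓜.abs_log_p_le hδ hp _ _)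

theorem energyIntegral_energy [IsFiniteMeasure Θ] {δ : ℝ} (hδ : 0 < δ)
    (hp : ∀ e, ∀ y ∈ 𝓜.vset (𝓜.init e), δ ≤ 𝓜.p e y) (hY : ∀ᵐ σ ∂Θ, σ ∈ 𝓜.codingDomain x) :
    energyIntegral Θ (𝓜.energy x) =
      ((∫ σ, Real.log (𝓜.p (σ 1) (𝓜.codingMap x σ)) ∂Θ : ℝ) : EReal) := by
  have hnonneg : ∀ σ, 0 ≤ -Real.log (𝓜.p (σ 1) (𝓜.codingMap x σ)) := fun σ =>
    neg_nonneg.2 (𝓜.log_p_nonpos _ _)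
  have hlint : ∫⁻ σ, (-𝓜.energy x σ).toENNReal ∂Θ =
      ENNReal.ofReal (∫ σ, -Real.log (𝓜.p (σ 1) (𝓜.codingMap x σ)) ∂Θ) := by
    rw [ofReal_integral_eq_lintegral_ofReal (f := fun σ => -Real.log (𝓜.p (σ 1) (𝓜.codingMap x σ)))
      (integrable_log_p_codingMap hδ hp).neg (Eventually.of_forall hnonneg)]
    refine lintegral_congr_ae ?_
    filter_upwards [hY] with σ hσ
    rw [energy, if_pos hσ, ← EReal.coe_neg, EReal.toENNReal_of_ne_top (EReal.coe_ne_top _),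
      EReal.toReal_coe]
  rw [energyIntegral, hlint, EReal.coe_ennreal_ofReal, max_eq_left (integral_nonneg hnonneg),
    integral_neg, EReal.coe_neg, neg_neg]

theorem ae_mem_codingDomain (h : energyIntegral Θ (𝓜.energy x) ≠ ⊥) :
    ∀ᵐ σ ∂Θ, σ ∈ 𝓜.codingDomain x := by
  have hfin : ∫⁻ σ, (-𝓜.energy x σ).toENNReal ∂Θ ≠ ∞ := fun htop => h (by
    rw [energyIntegral, htop]; rfl)
  have hmeas : Measurable fun σ => (-𝓜.energy x σ).toENNReal :=
    (isEnergyFunction_energy x).1.neg.ereal_toENNReal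
  filter_upwards [ae_lt_top hmeas hfin] with σ hσ
  by_contra hcon
  rw [energy, if_neg hcon] at hσ
  simp at hσ

end Measurability

end Coding

/-! ### The generalized Markov measure -/

namespace IsGeneralizedMarkovMeasure

section Words

variable {K V E : Type*} [MeasurableSpace K] [Fintype E] {𝓜 : MarkovSystem K V E}
  [MeasurableSpace E] {μ : Measure K} {M : Measure (ℤ → E)}

theorem isProbabilityMeasure [IsProbabilityMeasure μ] (hM : 𝓜.IsGeneralizedMarkovMeasure μ M) :
    IsProbabilityMeasure M :=
  ⟨by simpa [codeCylinder, pathProb] using hM 0 []⟩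

theorem real_codeCylinder (hM : 𝓜.IsGeneralizedMarkovMeasure μ M) (m : ℤ) (l : List E) :
    M.real (codeCylinder m l) = ∫ y, 𝓜.pathProb l y ∂μ := by
  rw [Measure.real, hM, ENNReal.toReal_ofReal (integral_nonneg (𝓜.pathProb_nonneg l))]

theorem real_wordAt (hM : 𝓜.IsGeneralizedMarkovMeasure μ M) (m : ℤ) {n : ℕ} (v : Fin n → E) :
    M.real (wordAt m n ⁻¹' {v}) = ∫ y, 𝓜.pathProb (List.ofFn v) y ∂μ := by
  rw [← codeCylinder_ofFn, hM.real_codeCylinder]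

variable [DiscreteMeasurableSpace E]

theorem eq_of_real_wordAt [IsProbabilityMeasure μ] (hM : 𝓜.IsGeneralizedMarkovMeasure μ M)
    {Θ : Measure (ℤ → E)} [IsFiniteMeasure Θ] (h : ∀ (m : ℤ) (n : ℕ) (v : Fin n → E),
      Θ.real (wordAt m n ⁻¹' {v}) = ∫ y, 𝓜.pathProb (List.ofFn v) y ∂μ) : Θ = M := by
  have := hM.isProbabilityMeasure
  refine ext_of_wordAt fun m n v => ?_
  rw [← ofReal_measureReal, ← ofReal_measureReal, h, hM.real_wordAt]

theorem isInvariantProb [IsProbabilityMeasure μ] (hM : 𝓜.IsGeneralizedMarkovMeasure μ M) :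
    IsInvariantProb leftShift M := by
  have hprob := hM.isProbabilityMeasure
  have hmeas : Measurable (leftShift : (ℤ → E) → ℤ → E) := measurable_shiftBy 1
  have := Measure.isProbabilityMeasure_map (μ := M) hmeas.aemeasurable
  refine ⟨hprob, hmeas, hM.eq_of_real_wordAt fun m n v => ?_⟩
  rw [map_measureReal_apply hmeas (measurable_wordAt m n (MeasurableSet.singleton v)),
    ← hM.real_wordAt (m + 1) v]
  congr 1
  ext σ
  simp only [Set.mem_preimage, Set.mem_singleton_iff, funext_iff, wordAt, leftShift, shiftBy,
    add_right_comm m]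

theorem setIntegral_letter_wordAt [IsProbabilityMeasure μ]
    (hM : 𝓜.IsGeneralizedMarkovMeasure μ M) {m j : ℤ} {n : ℕ} (hj : m + n = j) (e : E)
    (Ψ : (Fin n → E) → ℝ) :
    ∫ σ in {σ | σ j = e}, Ψ (wordAt m n σ) ∂M =
      ∑ v, (∫ y, 𝓜.pathProb (List.ofFn v ++ [e]) y ∂μ) * Ψ v := by
  have := hM.isProbabilityMeasure
  rw [integral_comp_eq_sum (measurable_wordAt m n)]
  refine Finset.sum_congr rfl fun v _ => ?_
  rw [measureReal_restrict_apply (measurable_wordAt m n (MeasurableSet.singleton v)),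
    ← hM.real_codeCylinder m, codeCylinder_append_singleton, codeCylinder_ofFn, List.length_ofFn,
    hj]

end Words

end IsGeneralizedMarkovMeasure

section Deviation

variable {K V E : Type*} [MeasurableSpace K] [Fintype E] {𝓜 : MarkovSystem K V E}

variable (𝓜) in
/-- The mean deviation of `f` between the end points of a random path of length `k + 1` that starts
at `y` and of the path that follows the same edges from the base point of its initial vertex. It
bounds the error that is made in replacing the coding map by its `k`-th approximation. -/
def meanDeviation (f : K → ℝ) (x : V → K) (k : ℕ) (y : K) : ℝ :=
  ∑ v : Fin (k + 1) → E, 𝓜.pathProb (List.ofFn v) y *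
    |f (𝓜.wordMap (List.ofFn v) y) - f (𝓜.wordMap (List.ofFn v) (x (𝓜.init (v 0))))|

variable {f : K → ℝ} {x : V → K}

theorem meanDeviation_nonneg (k : ℕ) (y : K) : 0 ≤ 𝓜.meanDeviation f x k y :=
  Finset.sum_nonneg fun _ _ => mul_nonneg (𝓜.pathProb_nonneg _ _) (abs_nonneg _)

theorem measurable_meanDeviation (hf : Measurable f) (k : ℕ) :
    Measurable (𝓜.meanDeviation f x k) :=
  Finset.measurable_sum _ fun _ _ => (𝓜.pathProb_measurable _).mul
    (continuous_abs.measurable.comp ((hf.comp (𝓜.measurable_wordMap _)).sub_const _))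

theorem meanDeviation_le {C : ℝ} (hC : ∀ y, |f y| ≤ C) (k : ℕ) (y : K) :
    𝓜.meanDeviation f x k y ≤ C + C := by
  have hsub : ∀ y z, |f y - f z| ≤ C + C := fun y z =>
    (abs_sub _ _).trans (add_le_add (hC y) (hC z))
  calc 𝓜.meanDeviation f x k y ≤ ∑ v : Fin (k + 1) → E, 𝓜.pathProb (List.ofFn v) y * (C + C) :=
        Finset.sum_le_sum fun v _ => mul_le_mul_of_nonneg_left (hsub _ _) (𝓜.pathProb_nonneg _ _)
    _ = C + C := by rw [← Finset.sum_mul, 𝓜.sum_pathProb, one_mul]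

theorem norm_meanDeviation_le {C : ℝ} (hC : ∀ y, |f y| ≤ C) (k : ℕ) (y : K) :
    ‖𝓜.meanDeviation f x k y‖ ≤ C + C := by
  rw [Real.norm_of_nonneg (meanDeviation_nonneg k y)]
  exact meanDeviation_le hC k y

variable {μ : Measure K}

theorem IsInvariant.integral_p_mul (hμ : 𝓜.IsInvariant μ) (e : E) (hf : Measurable f) {C : ℝ}
    (hC : ∀ y, |f y| ≤ C) (n : ℕ) :
    ∫ y, 𝓜.p e y * f y ∂μ = ∫ y, ∑ v : Fin n → E, 𝓜.pathProb (List.ofFn v ++ [e]) y *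
      f (𝓜.wordMap (List.ofFn v) y) ∂μ := by
  have hbound : ∀ y, |𝓜.p e y * f y| ≤ C := fun y => by
    rw [abs_mul, abs_of_nonneg (𝓜.p_nonneg e y)]
    exact (mul_le_of_le_one_left (abs_nonneg _) (𝓜.p_le_one e y)).trans (hC y)
  rw [← hμ.integral_markovOp_iterate (f := fun y => 𝓜.p e y * f y) ((𝓜.p_measurable e).mul hf)
    hbound n]
  simp only [← sum_pathProb_mul_wordMap, pathProb_append_singleton, mul_assoc]

variable [MeasurableSpace E] [DiscreteMeasurableSpace E] {M : Measure (ℤ → E)}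

theorem IsGeneralizedMarkovMeasure.setIntegral_backPoint [IsProbabilityMeasure μ]
    (hM : 𝓜.IsGeneralizedMarkovMeasure μ M) (e : E) (f : K → ℝ) (k : ℕ) :
    ∫ σ in {σ | σ 1 = e}, f (𝓜.backPoint x σ k) ∂M =
      ∫ y, ∑ v : Fin (k + 1) → E, 𝓜.pathProb (List.ofFn v ++ [e]) y *
        f (𝓜.wordMap (List.ofFn v) (x (𝓜.init (v 0)))) ∂μ := by
  rw [integral_finsetSum _ fun v _ => (𝓜.integrable_pathProb μ _).mul_const _]
  simp only [integral_mul_const]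
  rw [← hM.setIntegral_letter_wordAt (m := -(k : ℤ)) (j := 1) (by push_cast; ring) e
    fun v => f (𝓜.wordMap (List.ofFn v) (x (𝓜.init (v 0))))]
  simp [backPoint, backComp_eq_wordMap, wordAt]

theorem IsGeneralizedMarkovMeasure.abs_setIntegral_backPoint_sub_le
    (hM : 𝓜.IsGeneralizedMarkovMeasure μ M) (hμ : 𝓜.IsInvariant μ) (e : E) (hf : Measurable f)
    {C : ℝ} (hC : ∀ y, |f y| ≤ C) (k : ℕ) :
    |∫ σ in {σ | σ 1 = e}, f (𝓜.backPoint x σ k) ∂M - ∫ y, 𝓜.p e y * f y ∂μ| ≤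
      ∫ y, 𝓜.meanDeviation f x k y ∂μ := by
  have := hμ.1
  have hint : Integrable (𝓜.meanDeviation f x k) μ :=
    .of_bound (measurable_meanDeviation hf k).aestronglyMeasurable _
      (Eventually.of_forall (norm_meanDeviation_le hC k))
  have hprod : ∀ v : Fin (k + 1) → E, Integrable (fun y => 𝓜.pathProb (List.ofFn v ++ [e]) y *
      f (𝓜.wordMap (List.ofFn v) y)) μ := fun v =>
    (𝓜.integrable_pathProb μ _).mul_bdd (c := C)
      (hf.comp (𝓜.measurable_wordMap _)).aestronglyMeasurable (Eventually.of_forall fun y => hC _)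
  rw [abs_sub_comm, ← Real.norm_eq_abs, hM.setIntegral_backPoint,
    hμ.integral_p_mul e hf hC (k + 1), ← integral_sub
    (integrable_finsetSum _ fun v _ => hprod v)
    (integrable_finsetSum _ fun v _ => (𝓜.integrable_pathProb μ _).mul_const _)]
  refine norm_integral_le_of_norm_le hint (Eventually.of_forall fun y => ?_)
  rw [← Finset.sum_sub_distrib]
  refine (norm_sum_le _ _).trans (Finset.sum_le_sum fun v _ => ?_)
  rw [← mul_sub, norm_mul, Real.norm_of_nonneg (𝓜.pathProb_nonneg _ _), Real.norm_eq_abs,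
    pathProb_append_singleton]
  exact mul_le_mul_of_nonneg_right
    (mul_le_of_le_one_right (𝓜.pathProb_nonneg _ _) (𝓜.p_le_one _ _)) (abs_nonneg _)

end Deviation

section Convergence

variable {K V E : Type*} [MetricSpace K] [MeasurableSpace K] [Fintype E] {𝓜 : MarkovSystem K V E}
  {f : K → ℝ} {x : V → K}

theorem meanDeviation_le_pow {L : NNReal} (hf : LipschitzWith L f) {a : ℝ} (ha0 : 0 ≤ a)
    (ha : ∀ i, ∀ y ∈ 𝓜.vset i, ∀ z ∈ 𝓜.vset i,
      ∑ e, 𝓜.p e y * dist (𝓜.w e y) (𝓜.w e z) ≤ a * dist y z)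
    (hx : ∀ i, x i ∈ 𝓜.vset i) {i : V} {y : K} (hy : y ∈ 𝓜.vset i) (k : ℕ) :
    𝓜.meanDeviation f x k y ≤ L * (a ^ (k + 1) * dist y (x i)) := by
  refine le_trans ?_ (mul_le_mul_of_nonneg_left
    (sum_pathProb_mul_dist_wordMap_le ha0 ha (k + 1) hy (hx i)) L.coe_nonneg)
  rw [Finset.mul_sum]
  refine Finset.sum_le_sum fun v _ => ?_
  by_cases h : 𝓜.pathProb (List.ofFn v) y = 0
  · simp only [h, zero_mul, mul_zero, le_refl]
  · rw [𝓜.init_eq_of_pathProb_ne_zero h hy, mul_left_comm, ← Real.dist_eq]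
    exact mul_le_mul_of_nonneg_left (hf.dist_le_mul _ _) (𝓜.pathProb_nonneg _ _)

theorem tendsto_meanDeviation (hcontr : 𝓜.IsContractive) (hx : ∀ i, x i ∈ 𝓜.vset i) {L : NNReal}
    (hf : LipschitzWith L f) (y : K) :
    Tendsto (fun k => 𝓜.meanDeviation f x k y) atTop (𝓝 0) := by
  obtain ⟨a, ha0, ha1, ha⟩ := hcontr
  obtain ⟨i, hy⟩ := 𝓜.exists_mem_vset y
  have hpow := (((tendsto_add_atTop_iff_nat 1).2
    (tendsto_pow_atTop_nhds_zero_of_lt_one ha0.le ha1)).mul_const (dist y (x i))).const_mul (L : ℝ)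
  exact squeeze_zero (meanDeviation_nonneg · y) (meanDeviation_le_pow hf ha0.le ha hx hy)
    (by simpa using hpow)

variable [BorelSpace K]

theorem tendsto_integral_meanDeviation {μ : Measure K} [IsFiniteMeasure μ]
    (hcontr : 𝓜.IsContractive) (hx : ∀ i, x i ∈ 𝓜.vset i) {L : NNReal} (hf : LipschitzWith L f)
    {C : ℝ} (hC : ∀ y, |f y| ≤ C) :
    Tendsto (fun k => ∫ y, 𝓜.meanDeviation f x k y ∂μ) atTop (𝓝 0) := by
  simpa using tendsto_integral_of_dominated_convergence (μ := μ) (f := fun _ => 0)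
    (fun _ => C + C)
    (fun k => (measurable_meanDeviation (𝓜 := 𝓜) hf.continuous.measurable k).aestronglyMeasurable)
    (integrable_const _) (fun k => Eventually.of_forall (norm_meanDeviation_le hC k))
    (Eventually.of_forall (tendsto_meanDeviation hcontr hx hf))

variable [MeasurableSpace E] [DiscreteMeasurableSpace E] {μ : Measure K} {M : Measure (ℤ → E)}

theorem IsGeneralizedMarkovMeasure.setIntegral_codingMap_of_lipschitz
    (hM : 𝓜.IsGeneralizedMarkovMeasure μ M) (hμ : 𝓜.IsInvariant μ) (hcontr : 𝓜.IsContractive)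
    (hx : ∀ i, x i ∈ 𝓜.vset i) (hY : ∀ᵐ σ ∂M, σ ∈ 𝓜.codingDomain x) (e : E) {L : NNReal}
    (hf : LipschitzWith L f) {C : ℝ} (hC : ∀ y, |f y| ≤ C) :
    ∫ σ in {σ | σ 1 = e}, f (𝓜.codingMap x σ) ∂M = ∫ y, 𝓜.p e y * f y ∂μ := by
  have := hμ.1
  have := hM.isProbabilityMeasure
  have hcod : Tendsto (fun k => ∫ σ in {σ | σ 1 = e}, f (𝓜.backPoint x σ k) ∂M) atTop
      (𝓝 (∫ σ in {σ | σ 1 = e}, f (𝓜.codingMap x σ) ∂M)) := by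
    refine tendsto_integral_of_dominated_convergence (fun _ => C)
      (fun k => (hf.continuous.measurable.comp (measurable_backPoint x k)).aestronglyMeasurable)
      (integrable_const _) (fun k => Eventually.of_forall fun σ => hC _) (ae_restrict_of_ae ?_)
    filter_upwards [hY] with σ hσ
    exact (hf.continuous.tendsto _).comp (tendsto_backPoint (mem_limitSet_of_mem_codingDomain hσ))
  have hinv : Tendsto (fun k => ∫ σ in {σ | σ 1 = e}, f (𝓜.backPoint x σ k) ∂M) atTop
      (𝓝 (∫ y, 𝓜.p e y * f y ∂μ)) := tendsto_iff_dist_tendsto_zero.2 (squeeze_zero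
    (fun _ => dist_nonneg) (hM.abs_setIntegral_backPoint_sub_le hμ e hf.continuous.measurable hC)
    (tendsto_integral_meanDeviation hcontr hx hf hC))
  exact tendsto_nhds_unique hcod hinv

end Convergence

end MarkovSystem

section Lipschitz

variable {K : Type*} [PseudoEMetricSpace K] [MeasurableSpace K] [BorelSpace K]

theorem measure_eq_of_forall_lipschitz_integral_eq {μ ν : Measure K} [IsFiniteMeasure μ]
    [IsFiniteMeasure ν] (h : ∀ (L : NNReal) (f : K → ℝ), LipschitzWith L f → (∀ y, |f y| ≤ 1) →
      ∫ y, f y ∂μ = ∫ y, f y ∂ν) : μ = ν := by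
  have hclosed : ∀ F : Set K, IsClosed F → μ F = ν F := fun F hF => by
    have hpos : ∀ n : ℕ, (0 : ℝ) < 1 / ((n : ℝ) + 1) := fun n => by positivity
    have hlim := fun (ν : Measure K) [IsFiniteMeasure ν] =>
      tendsto_integral_thickenedIndicator_of_isClosed ν hF hpos
        tendsto_one_div_add_atTop_nhds_zero_nat
    have heq := tendsto_nhds_unique (hlim μ) ((hlim ν).congr fun n => (h _ _
      (NNReal.isometry_coe.lipschitz.comp (lipschitzWith_thickenedIndicator (hpos n) F))
      fun y => ?_).symm)
    · rwa [measureReal_eq_measureReal_iff] at heq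
    · rw [Function.comp_apply, abs_of_nonneg (NNReal.coe_nonneg _)]
      exact_mod_cast thickenedIndicator_le_one (hpos n) F y
  exact ext_of_generate_finite _ (BorelSpace.measurable_eq.trans borel_eq_generateFrom_isClosed)
    isPiSystem_isClosed hclosed (hclosed _ isClosed_univ)

end Lipschitz

namespace MarkovSystem

section Image

variable {K V E : Type*} [MetricSpace K] [PolishSpace K] [MeasurableSpace K] [BorelSpace K]
  [Fintype E] {𝓜 : MarkovSystem K V E} [MeasurableSpace E] [DiscreteMeasurableSpace E]
  {μ : Measure K} {M : Measure (ℤ → E)} {x : V → K}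

namespace IsGeneralizedMarkovMeasure

theorem map_restrict_letter (hM : 𝓜.IsGeneralizedMarkovMeasure μ M) (hμ : 𝓜.IsInvariant μ)
    (hcontr : 𝓜.IsContractive) (hx : ∀ i, x i ∈ 𝓜.vset i)
    (hY : ∀ᵐ σ ∂M, σ ∈ 𝓜.codingDomain x) (e : E) :
    (M.restrict {σ | σ 1 = e}).map (𝓜.codingMap x) =
      μ.withDensity fun y => ENNReal.ofReal (𝓜.p e y) := by
  have := hμ.1
  have := hM.isProbabilityMeasure
  have hint : Integrable (𝓜.p e) μ := .of_bound (𝓜.p_measurable e).aestronglyMeasurable 1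
    (Eventually.of_forall fun y => by
      rw [Real.norm_of_nonneg (𝓜.p_nonneg e y)]; exact 𝓜.p_le_one e y)
  have := isFiniteMeasure_withDensity_ofReal hint.2
  refine measure_eq_of_forall_lipschitz_integral_eq fun L f hf hf1 => ?_
  rw [integral_map (measurable_codingMap x).aemeasurable hf.continuous.aestronglyMeasurable,
    hM.setIntegral_codingMap_of_lipschitz hμ hcontr hx hY e hf hf1,
    integral_withDensity_eq_integral_toReal_smul (𝓜.p_measurable e).ennreal_ofReal
      (Eventually.of_forall fun _ => ENNReal.ofReal_lt_top)]
  simp only [ENNReal.toReal_ofReal (𝓜.p_nonneg e _), smul_eq_mul]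

theorem map_codingMap (hM : 𝓜.IsGeneralizedMarkovMeasure μ M) (hμ : 𝓜.IsInvariant μ)
    (hcontr : 𝓜.IsContractive) (hx : ∀ i, x i ∈ 𝓜.vset i)
    (hY : ∀ᵐ σ ∂M, σ ∈ 𝓜.codingDomain x) : M.map (𝓜.codingMap x) = μ := by
  have := hμ.1
  have := hM.isProbabilityMeasure
  have hF := measurable_codingMap (𝓜 := 𝓜) x
  refine measure_eq_of_forall_lipschitz_integral_eq fun L f hf hf1 => ?_
  have hfm := hf.continuous.measurable
  have hint : Integrable (fun σ => f (𝓜.codingMap x σ)) M := .of_bound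
    (hfm.comp hF).aestronglyMeasurable 1 (Eventually.of_forall fun _ => hf1 _)
  have hprod : ∀ e, Integrable (fun y => 𝓜.p e y * f y) μ := fun e => .of_bound
    ((𝓜.p_measurable e).mul hfm).aestronglyMeasurable 1 (Eventually.of_forall fun y => by
      rw [norm_mul, Real.norm_of_nonneg (𝓜.p_nonneg e y)]
      exact mul_le_one₀ (𝓜.p_le_one e y) (norm_nonneg _) (hf1 y))
  calc ∫ y, f y ∂(M.map (𝓜.codingMap x)) = ∫ σ, f (𝓜.codingMap x σ) ∂M :=
        integral_map hF.aemeasurable hfm.aestronglyMeasurable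
    _ = ∑ e, ∫ σ in {σ | σ 1 = e}, f (𝓜.codingMap x σ) ∂M := integral_eq_sum_letter hint 1
    _ = ∑ e, ∫ y, 𝓜.p e y * f y ∂μ := Finset.sum_congr rfl fun e _ =>
        hM.setIntegral_codingMap_of_lipschitz hμ hcontr hx hY e hf hf1
    _ = ∫ y, f y ∂μ := by
        rw [← integral_finsetSum _ fun e _ => hprod e]
        simp only [← Finset.sum_mul, 𝓜.p_sum, one_mul]

theorem setIntegral_codingMap (hM : 𝓜.IsGeneralizedMarkovMeasure μ M) (hμ : 𝓜.IsInvariant μ)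
    (hcontr : 𝓜.IsContractive) (hx : ∀ i, x i ∈ 𝓜.vset i)
    (hY : ∀ᵐ σ ∂M, σ ∈ 𝓜.codingDomain x) (e : E) {f : K → ℝ} (hf : Measurable f) :
    ∫ σ in {σ | σ 1 = e}, f (𝓜.codingMap x σ) ∂M = ∫ y, 𝓜.p e y * f y ∂μ := by
  rw [← integral_map (measurable_codingMap x).aemeasurable hf.aestronglyMeasurable,
    hM.map_restrict_letter hμ hcontr hx hY, integral_withDensity_eq_integral_toReal_smul
      (𝓜.p_measurable e).ennreal_ofReal (Eventually.of_forall fun _ => ENNReal.ofReal_lt_top)]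
  simp only [ENNReal.toReal_ofReal (𝓜.p_nonneg e _), smul_eq_mul]

theorem integral_log_p_codingMap (hM : 𝓜.IsGeneralizedMarkovMeasure μ M) (hμ : 𝓜.IsInvariant μ)
    (hcontr : 𝓜.IsContractive) {δ : ℝ} (hδ : 0 < δ)
    (hp : ∀ e, ∀ y ∈ 𝓜.vset (𝓜.init e), δ ≤ 𝓜.p e y) (hx : ∀ i, x i ∈ 𝓜.vset i)
    (hY : ∀ᵐ σ ∂M, σ ∈ 𝓜.codingDomain x) :
    ∫ σ, Real.log (𝓜.p (σ 1) (𝓜.codingMap x σ)) ∂M =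
      ∑ e, ∫ y, 𝓜.p e y * Real.log (𝓜.p e y) ∂μ := by
  have := hμ.1
  have := hM.isProbabilityMeasure
  rw [integral_eq_sum_letter (integrable_log_p_codingMap hδ hp) 1]
  refine Finset.sum_congr rfl fun e _ => ?_
  rw [← hM.setIntegral_codingMap (f := fun y => Real.log (𝓜.p e y)) hμ hcontr hx hY e
    (Real.measurable_log.comp (𝓜.p_measurable e))]
  refine setIntegral_congr_fun (measurableSet_eq_letter 1 e) fun σ (hσ : σ 1 = e) => ?_
  simp only [hσ]

end IsGeneralizedMarkovMeasure

end Image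

/-! ### The entropy of the generalized Markov measure -/

section LowerBound

variable {K V E : Type*} [MeasurableSpace K] [Fintype E] {𝓜 : MarkovSystem K V E}

theorem sum_negMulLog_pathProb_succ (n : ℕ) (y : K) :
    ∑ v : Fin (n + 1) → E, Real.negMulLog (𝓜.pathProb (List.ofFn v) y) =
      ∑ e, Real.negMulLog (𝓜.p e y) +
        𝓜.markovOp (fun z => ∑ v : Fin n → E, Real.negMulLog (𝓜.pathProb (List.ofFn v) z)) y := by
  rw [← (Fin.consEquiv fun _ : Fin (n + 1) => E).sum_comp, Fintype.sum_prod_type, markovOp,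
    ← Finset.sum_add_distrib]
  refine Finset.sum_congr rfl fun e _ => ?_
  simp only [Fin.consEquiv, Equiv.coe_fn_mk, List.ofFn_cons, pathProb, Real.negMulLog_mul]
  rw [Finset.sum_add_distrib, ← Finset.sum_mul, 𝓜.sum_pathProb, one_mul, Finset.mul_sum]

theorem abs_negMulLog_pathProb_le_one (l : List E) (y : K) :
    |Real.negMulLog (𝓜.pathProb l y)| ≤ 1 := by
  have h0 := 𝓜.pathProb_nonneg l y
  rw [abs_of_nonneg (Real.negMulLog_nonneg h0 (𝓜.pathProb_le_one l y))]
  exact (Real.negMulLog_le_one_sub_self h0).trans (sub_le_self 1 h0)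

theorem measurable_negMulLog_pathProb (l : List E) :
    Measurable fun y => Real.negMulLog (𝓜.pathProb l y) :=
  Real.continuous_negMulLog.measurable.comp (𝓜.pathProb_measurable l)

theorem integrable_negMulLog_pathProb (μ : Measure K) [IsFiniteMeasure μ] (l : List E) :
    Integrable (fun y => Real.negMulLog (𝓜.pathProb l y)) μ :=
  .of_bound (measurable_negMulLog_pathProb l).aestronglyMeasurable 1
    (Eventually.of_forall (abs_negMulLog_pathProb_le_one l))

theorem integrable_negMulLog_p (μ : Measure K) [IsFiniteMeasure μ] (e : E) :
    Integrable (fun y => Real.negMulLog (𝓜.p e y)) μ := by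
  simpa only [pathProb, mul_one] using integrable_negMulLog_pathProb (𝓜 := 𝓜) μ [e]

theorem integral_sum_negMulLog_pathProb {μ : Measure K} (hμ : 𝓜.IsInvariant μ) (n : ℕ) :
    ∫ y, ∑ v : Fin n → E, Real.negMulLog (𝓜.pathProb (List.ofFn v) y) ∂μ =
      n * ∫ y, ∑ e, Real.negMulLog (𝓜.p e y) ∂μ := by
  have := hμ.1
  induction n with
  | zero => simp [pathProb]
  | succ n ih =>
    have hm : Measurable fun z => ∑ v : Fin n → E, Real.negMulLog (𝓜.pathProb (List.ofFn v) z) :=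
      Finset.measurable_sum _ fun v _ => measurable_negMulLog_pathProb _
    have hb : ∀ z, |∑ v : Fin n → E, Real.negMulLog (𝓜.pathProb (List.ofFn v) z)| ≤
        ∑ _v : Fin n → E, (1 : ℝ) := fun z =>
      (Finset.abs_sum_le_sum_abs _ _).trans
        (Finset.sum_le_sum fun v _ => abs_negMulLog_pathProb_le_one _ z)
    simp only [sum_negMulLog_pathProb_succ]
    rw [integral_add (integrable_finsetSum _ fun e _ => integrable_negMulLog_p μ e)
      (.of_bound (𝓜.measurable_markovOp hm).aestronglyMeasurable _
        (Eventually.of_forall (𝓜.abs_markovOp_le hb))), hμ.2 _ hm ⟨_, hb⟩, ih]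
    push_cast
    ring

theorem integral_sum_negMulLog_p (μ : Measure K) [IsFiniteMeasure μ] :
    ∫ y, ∑ e, Real.negMulLog (𝓜.p e y) ∂μ =
      -∑ e, ∫ y, 𝓜.p e y * Real.log (𝓜.p e y) ∂μ := by
  rw [integral_finsetSum _ fun e _ => integrable_negMulLog_p μ e]
  simp only [Real.negMulLog, neg_mul, integral_neg, Finset.sum_neg_distrib]

variable [MeasurableSpace E] {μ : Measure K} {M : Measure (ℤ → E)}

namespace IsGeneralizedMarkovMeasure

theorem partitionEntropy_itinerary (hM : 𝓜.IsGeneralizedMarkovMeasure μ M) (n : ℕ) :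
    partitionEntropy M (itinerary leftShift (fun σ => Fintype.equivFin E (σ 0)) n) =
      ∑ v : Fin n → E, Real.negMulLog (∫ y, 𝓜.pathProb (List.ofFn v) y ∂μ) := by
  rw [partitionEntropy, ← (Equiv.piCongrRight fun _ : Fin n => Fintype.equivFin E).sum_comp]
  refine Finset.sum_congr rfl fun v _ => ?_
  rw [← hM.real_wordAt 0 v]
  congr 2
  ext σ
  simp only [Set.mem_preimage, Set.mem_singleton_iff, funext_iff, itinerary, wordAt,
    leftShift_iterate, shiftBy, Equiv.piCongrRight_apply, Pi.map_apply,
    EmbeddingLike.apply_eq_iff_eq]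

theorem mul_integral_le_partitionEntropy (hM : 𝓜.IsGeneralizedMarkovMeasure μ M)
    (hμ : 𝓜.IsInvariant μ) (n : ℕ) : n * ∫ y, ∑ e, Real.negMulLog (𝓜.p e y) ∂μ ≤
      partitionEntropy M (itinerary leftShift (fun σ => Fintype.equivFin E (σ 0)) n) := by
  have := hμ.1
  rw [hM.partitionEntropy_itinerary, ← integral_sum_negMulLog_pathProb hμ,
    integral_finsetSum _ fun v _ => integrable_negMulLog_pathProb μ _]
  exact Finset.sum_le_sum fun v _ => Real.concaveOn_negMulLog.le_map_integral
    Real.continuous_negMulLog.continuousOn isClosed_Ici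
    (Eventually.of_forall fun y => 𝓜.pathProb_nonneg _ y) (𝓜.integrable_pathProb μ _)
    (integrable_negMulLog_pathProb μ _)

theorem le_ksEntropy [DiscreteMeasurableSpace E] (hM : 𝓜.IsGeneralizedMarkovMeasure μ M)
    (hμ : 𝓜.IsInvariant μ) :
    ((-∑ e, ∫ y, 𝓜.p e y * Real.log (𝓜.p e y) ∂μ : ℝ) : EReal) ≤
      ksEntropy M (leftShift : (ℤ → E) → (ℤ → E)) := by
  have := hμ.1
  have hξ : Measurable fun σ : ℤ → E => Fintype.equivFin E (σ 0) :=
    (Measurable.of_discrete (f := Fintype.equivFin E)).comp (measurable_pi_apply 0)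
  refine le_trans ?_ (le_iSup_of_le _ (le_iSup_of_le _ (le_iSup_of_le hξ le_rfl)))
  refine (limsup_const _).symm.trans_le (limsup_le_limsup ?_)
  filter_upwards [eventually_gt_atTop 0] with n hn
  rw [EReal.coe_le_coe_iff, ← integral_sum_negMulLog_p, le_div_iff₀' (by exact_mod_cast hn)]
  exact hM.mul_integral_le_partitionEntropy hμ n

end IsGeneralizedMarkovMeasure

end LowerBound

/-! ### Equilibrium states -/

section TransitionProb

variable {K V E : Type*} [MeasurableSpace K] [Fintype E] {𝓜 : MarkovSystem K V E}
  [MeasurableSpace E] {Θ : Measure (ℤ → E)} {F : (ℤ → E) → K}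

/-- `F` is a state map for `𝓜` and `Θ`: the sequence of the points `F (S ^ n σ)` is, under `Θ`, the
Markov process of `𝓜` driven by the letters of `σ`. At time `0` the state is a function of the past,
the next letter is `e` with conditional probability `p_e`, and it moves the state by `w_e`. -/
structure IsStateMap (𝓜 : MarkovSystem K V E) (Θ : Measure (ℤ → E)) (F : (ℤ → E) → K) : Prop where
  measurable : Measurable F
  dependsOn : DependsOn F (Set.Iic 0)
  apply_leftShift : ∀ᵐ σ ∂Θ, F (leftShift σ) = 𝓜.w (σ 1) (F σ)
  hasTransitionProb : HasTransitionProb Θ fun e σ => 𝓜.p e (F σ)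

namespace IsStateMap

variable [DiscreteMeasurableSpace E]

theorem setIntegral_letter (hF : 𝓜.IsStateMap Θ F) (e : E) {f : K → ℝ} (hf : Measurable f)
    {h : (ℤ → E) → ℝ} (hh : Measurable h) (hdep : DependsOn h (Set.Iic 0)) :
    ∫ σ in {σ | σ 1 = e}, f (F (leftShift σ)) * h σ ∂Θ =
      ∫ σ, 𝓜.p e (F σ) * (f (𝓜.w e (F σ)) * h σ) ∂Θ := by
  rw [← hF.hasTransitionProb e (fun σ => f (𝓜.w e (F σ)) * h σ)
    ((hf.comp ((𝓜.w_measurable e).comp hF.measurable)).mul hh)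
    fun σ τ hστ => by simp only [hF.dependsOn hστ, hdep hστ]]
  refine setIntegral_congr_ae (measurableSet_eq_letter 1 e) ?_
  filter_upwards [hF.apply_leftShift] with σ hσ he
  rw [hσ, he]

theorem isInvariant_map [IsProbabilityMeasure Θ] (hF : 𝓜.IsStateMap Θ F)
    (hΘ : MeasurePreserving leftShift Θ Θ) : 𝓜.IsInvariant (Θ.map F) := by
  have hFm := hF.measurable
  refine ⟨Measure.isProbabilityMeasure_map hFm.aemeasurable, fun f hf ⟨C, hC⟩ => ?_⟩
  have hterm (e : E) : Integrable (fun σ => 𝓜.p e (F σ) * f (𝓜.w e (F σ))) Θ :=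
    .bdd_mul (.of_bound (hf.comp ((𝓜.w_measurable e).comp hFm)).aestronglyMeasurable C
        (Eventually.of_forall fun σ => hC _))
      ((𝓜.p_measurable e).comp hFm).aestronglyMeasurable (c := 1)
      (Eventually.of_forall fun σ => by
        rw [Real.norm_of_nonneg (𝓜.p_nonneg _ _)]; exact 𝓜.p_le_one _ _)
  have hshift : Integrable (fun σ => f (F (leftShift σ))) Θ :=
    .of_bound (hf.comp (hFm.comp hΘ.measurable)).aestronglyMeasurable C
      (Eventually.of_forall fun σ => hC _)
  calc ∫ y, 𝓜.markovOp f y ∂Θ.map F = ∫ σ, 𝓜.markovOp f (F σ) ∂Θ :=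
        integral_map hFm.aemeasurable (𝓜.measurable_markovOp hf).aestronglyMeasurable
    _ = ∑ e, ∫ σ, 𝓜.p e (F σ) * f (𝓜.w e (F σ)) ∂Θ := integral_finsetSum _ fun e _ => hterm e
    _ = ∑ e, ∫ σ in {σ | σ 1 = e}, f (F (leftShift σ)) ∂Θ := by
        refine Finset.sum_congr rfl fun e _ => ?_
        simpa using (hF.setIntegral_letter e hf (measurable_const (a := (1 : ℝ)))
          fun _ _ _ => rfl).symm
    _ = ∫ σ, f (F (leftShift σ)) ∂Θ := (integral_eq_sum_letter hshift 1).symm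
    _ = ∫ σ, f (F σ) ∂Θ := integral_comp_shiftBy hΘ 1 fun σ => f (F σ)
    _ = ∫ y, f y ∂Θ.map F := (integral_map hFm.aemeasurable hf.aestronglyMeasurable).symm

theorem setIntegral_codeCylinder (hF : 𝓜.IsStateMap Θ F) (hΘ : MeasurePreserving leftShift Θ Θ)
    (l : List E) {h : (ℤ → E) → ℝ} (hh : Measurable h) (hdep : DependsOn h (Set.Iic 0)) :
    ∫ σ in codeCylinder 1 l, h σ ∂Θ = ∫ σ, 𝓜.pathProb l (F σ) * h σ ∂Θ := by
  classical
  induction l generalizing h with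
  | nil => simp [codeCylinder, pathProb]
  | cons e l ih =>
    -- `g ∘ leftShift` is `h` on the cylinder set of `e`, and `g` depends on the past only.
    let g : (ℤ → E) → ℝ := {τ | τ 0 = e}.indicator fun τ => h (shiftBy (-1) τ)
    have hg : Measurable g :=
      (hh.comp (measurable_shiftBy (-1))).indicator (measurableSet_eq_letter 0 e)
    have hgdep : DependsOn g (Set.Iic 0) := fun σ τ hστ => by
      have h0 := hστ 0 (Set.mem_Iic.2 le_rfl)
      have hpast : h (shiftBy (-1) σ) = h (shiftBy (-1) τ) :=
        hdep fun j hj => hστ (j + -1) (by simp only [Set.mem_Iic] at hj ⊢; omega)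
      simp only [g, Set.indicator_apply, Set.mem_ofPred_eq, h0, hpast]
    have hg_shift (σ : ℤ → E) : g (leftShift σ) = {σ : ℤ → E | σ 1 = e}.indicator h σ := by
      simp only [g, Set.indicator_apply, leftShift, shiftBy_shiftBy, neg_add_cancel, shiftBy_zero]
      rfl
    calc ∫ σ in codeCylinder 1 (e :: l), h σ ∂Θ
        = ∫ σ in leftShift ⁻¹' codeCylinder 1 l, g (leftShift σ) ∂Θ := by
          rw [codeCylinder_cons, Set.inter_comm,
            ← setIntegral_indicator (measurableSet_eq_letter 1 e)]
          simp only [hg_shift]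
      _ = ∫ τ in codeCylinder 1 l, g τ ∂Θ :=
          hΘ.setIntegral_preimage_emb (shiftEquiv 1).measurableEmbedding g _
      _ = ∫ σ, 𝓜.pathProb l (F (leftShift σ)) * g (leftShift σ) ∂Θ := by
          rw [ih hg hgdep]
          exact (integral_comp_shiftBy hΘ 1 fun τ => 𝓜.pathProb l (F τ) * g τ).symm
      _ = ∫ σ in {σ | σ 1 = e}, 𝓜.pathProb l (F (leftShift σ)) * h σ ∂Θ := by
          rw [← integral_indicator (measurableSet_eq_letter 1 e)]
          simp only [hg_shift, Set.indicator_mul_right]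
      _ = ∫ σ, 𝓜.pathProb (e :: l) (F σ) * h σ ∂Θ := by
          rw [hF.setIntegral_letter e (𝓜.pathProb_measurable l) hh hdep]
          simp only [pathProb, mul_assoc]

theorem real_wordAt (hF : 𝓜.IsStateMap Θ F) (hΘ : MeasurePreserving leftShift Θ Θ)
    (m : ℤ) {n : ℕ} (v : Fin n → E) :
    Θ.real (wordAt m n ⁻¹' {v}) = ∫ y, 𝓜.pathProb (List.ofFn v) y ∂Θ.map F := by
  have hword : wordAt m n ⁻¹' {v} = shiftBy (m - 1) ⁻¹' codeCylinder 1 (List.ofFn v) := by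
    ext σ
    simp only [codeCylinder_ofFn, Set.mem_preimage, Set.mem_singleton_iff, funext_iff, wordAt,
      shiftBy, show ∀ j : ℕ, (1 : ℤ) + j + (m - 1) = m + j from fun j => by ring]
  have hmeas : MeasurableSet (codeCylinder 1 (List.ofFn v)) := by
    rw [codeCylinder_ofFn]
    exact measurable_wordAt 1 n (MeasurableSet.singleton v)
  have hcyl := hF.setIntegral_codeCylinder hΘ (List.ofFn v) (measurable_const (a := (1 : ℝ)))
    fun _ _ _ => rfl
  rw [hword, (measurePreserving_shiftBy hΘ _).measureReal_preimage hmeas.nullMeasurableSet,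
    integral_map hF.measurable.aemeasurable (𝓜.pathProb_measurable _).aestronglyMeasurable]
  simpa using hcyl

end IsStateMap

end TransitionProb

section Equilibrium

variable {K V E : Type*} [MeasurableSpace K] [Fintype E] {𝓜 : MarkovSystem K V E} {x : V → K}
  {δ : ℝ}

theorem isPastWeights_backPoint (x : V → K) :
    IsPastWeights fun k e σ => 𝓜.p e (𝓜.backPoint x σ k) where
  dependsOn k e _ _ h := congrArg (𝓜.p e) (dependsOn_backPoint x k h)
  nonneg _ _ _ := 𝓜.p_nonneg _ _
  sum_le_one _ _ := (𝓜.p_sum _).le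

section Topological

variable [TopologicalSpace K]

theorem le_p_backPoint (hp : ∀ e, ∀ y ∈ 𝓜.vset (𝓜.init e), δ ≤ 𝓜.p e y)
    (hx : ∀ i, x i ∈ 𝓜.vset i) {σ : ℤ → E} (hσ : σ ∈ 𝓜.codingDomain x) (k : ℕ) :
    δ ≤ 𝓜.p (σ 1) (𝓜.backPoint x σ k) :=
  hp _ _ (backPoint_mem hx (mem_limitSet_of_mem_codingDomain hσ).1 k)

theorem tendsto_p_backPoint (hopen : ∀ i, IsOpen (𝓜.vset i))
    (hcont : ∀ e, ContinuousOn (𝓜.p e) (𝓜.vset (𝓜.init e))) {σ : ℤ → E}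
    (hσ : σ ∈ 𝓜.codingDomain x) (e : E) :
    Tendsto (fun k => 𝓜.p e (𝓜.backPoint x σ k)) atTop (𝓝 (𝓜.p e (𝓜.codingMap x σ))) :=
  ((continuous_p hopen (hcont e)).tendsto _).comp
    (tendsto_backPoint (mem_limitSet_of_mem_codingDomain hσ))

variable [MeasurableSpace E] [DiscreteMeasurableSpace E] {Θ : Measure (ℤ → E)}

theorem ksEntropy_le_neg_integral_log_p [IsProbabilityMeasure Θ]
    (hΘ : MeasurePreserving leftShift Θ Θ) (hopen : ∀ i, IsOpen (𝓜.vset i))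
    (hcont : ∀ e, ContinuousOn (𝓜.p e) (𝓜.vset (𝓜.init e))) (hδ : 0 < δ)
    (hp : ∀ e, ∀ y ∈ 𝓜.vset (𝓜.init e), δ ≤ 𝓜.p e y) (hx : ∀ i, x i ∈ 𝓜.vset i)
    (hY : ∀ᵐ σ ∂Θ, σ ∈ 𝓜.codingDomain x) :
    ksEntropy Θ leftShift ≤
      ((-∫ σ, Real.log (𝓜.p (σ 1) (𝓜.codingMap x σ)) ∂Θ : ℝ) : EReal) :=
  ksEntropy_leftShift_le hΘ (isPastWeights_backPoint x) hδ
    (hY.mono fun _ hσ => le_p_backPoint hp hx hσ)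
    (hY.mono fun σ hσ => tendsto_p_backPoint hopen hcont hσ (σ 1))

variable [PolishSpace K] [BorelSpace K]

theorem ksEntropy_add_energyIntegral_nonpos (hΘ : IsInvariantProb leftShift Θ)
    (hopen : ∀ i, IsOpen (𝓜.vset i)) (hcont : ∀ e, ContinuousOn (𝓜.p e) (𝓜.vset (𝓜.init e)))
    (hδ : 0 < δ) (hp : ∀ e, ∀ y ∈ 𝓜.vset (𝓜.init e), δ ≤ 𝓜.p e y) (hx : ∀ i, x i ∈ 𝓜.vset i) :
    ksEntropy Θ leftShift + energyIntegral Θ (𝓜.energy x) ≤ 0 := by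
  have := hΘ.1
  by_cases hbot : energyIntegral Θ (𝓜.energy x) = ⊥
  · simp [hbot]
  have hY := ae_mem_codingDomain hbot
  rw [energyIntegral_energy hδ hp hY]
  refine (add_le_add_left (ksEntropy_le_neg_integral_log_p hΘ.2 hopen hcont hδ hp hx hY) _).trans ?_
  rw [← EReal.coe_add, neg_add_cancel, EReal.coe_zero]

theorem neg_integral_log_p_le_ksEntropy [IsFiniteMeasure Θ]
    (hδ : 0 < δ) (hp : ∀ e, ∀ y ∈ 𝓜.vset (𝓜.init e), δ ≤ 𝓜.p e y)
    (hY : ∀ᵐ σ ∂Θ, σ ∈ 𝓜.codingDomain x)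
    (hzero : 0 ≤ ksEntropy Θ leftShift + energyIntegral Θ (𝓜.energy x)) :
    ((-∫ σ, Real.log (𝓜.p (σ 1) (𝓜.codingMap x σ)) ∂Θ : ℝ) : EReal) ≤ ksEntropy Θ leftShift := by
  rw [energyIntegral_energy hδ hp hY] at hzero
  by_contra! hlt
  have := EReal.add_lt_add_right_coe hlt (∫ σ, Real.log (𝓜.p (σ 1) (𝓜.codingMap x σ)) ∂Θ)
  rw [← EReal.coe_add, neg_add_cancel, EReal.coe_zero] at this
  exact this.not_ge hzero

end Topological

variable [MetricSpace K] [PolishSpace K] [BorelSpace K] [MeasurableSpace E]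
  [DiscreteMeasurableSpace E] {Θ M : Measure (ℤ → E)} {μ : Measure K}

namespace IsGeneralizedMarkovMeasure

theorem eq_of_zero_le_ksEntropy_add_energyIntegral
    (hM : 𝓜.IsGeneralizedMarkovMeasure μ M) [IsProbabilityMeasure μ]
    (huniq : ∀ ν : Measure K, 𝓜.IsInvariant ν → ν = μ) (hcontr : 𝓜.IsContractive)
    (hopen : ∀ i, IsOpen (𝓜.vset i)) (hcont : ∀ e, ContinuousOn (𝓜.p e) (𝓜.vset (𝓜.init e)))
    (hδ : 0 < δ) (hp : ∀ e, ∀ y ∈ 𝓜.vset (𝓜.init e), δ ≤ 𝓜.p e y) (hx : ∀ i, x i ∈ 𝓜.vset i)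
    (hΘ : IsInvariantProb leftShift Θ)
    (hzero : 0 ≤ ksEntropy Θ leftShift + energyIntegral Θ (𝓜.energy x)) : Θ = M := by
  have := hΘ.1
  have hY : ∀ᵐ σ ∂Θ, σ ∈ 𝓜.codingDomain x := ae_mem_codingDomain fun hbot => by
    simp [hbot] at hzero
  have hF : 𝓜.IsStateMap Θ (𝓜.codingMap x) :=
    { measurable := measurable_codingMap x
      dependsOn := dependsOn_codingMap x
      apply_leftShift := hY.mono fun _ hσ =>
        codingMap_leftShift hopen (fun e => continuousOn_w hcontr hδ (hp e)) hx hσ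
      hasTransitionProb := hasTransitionProb_of_le_ksEntropy hΘ.2 (isPastWeights_backPoint x) hδ
        (hY.mono fun _ hσ => le_p_backPoint hp hx hσ)
        (fun e => hY.mono fun _ hσ => tendsto_p_backPoint hopen hcont hσ e)
        (neg_integral_log_p_le_ksEntropy hδ hp hY hzero) }
  refine hM.eq_of_real_wordAt fun m n v => ?_
  rw [hF.real_wordAt hΘ.2, huniq _ (hF.isInvariant_map hΘ.2)]

theorem ksEntropy_eq (hM : 𝓜.IsGeneralizedMarkovMeasure μ M)
    (hμ : 𝓜.IsInvariant μ) (hcontr : 𝓜.IsContractive) (hopen : ∀ i, IsOpen (𝓜.vset i))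
    (hcont : ∀ e, ContinuousOn (𝓜.p e) (𝓜.vset (𝓜.init e))) (hδ : 0 < δ)
    (hp : ∀ e, ∀ y ∈ 𝓜.vset (𝓜.init e), δ ≤ 𝓜.p e y) (hx : ∀ i, x i ∈ 𝓜.vset i)
    (hY : ∀ᵐ σ ∂M, σ ∈ 𝓜.codingDomain x) :
    ksEntropy M leftShift = ((-∑ e, ∫ y, 𝓜.p e y * Real.log (𝓜.p e y) ∂μ : ℝ) : EReal) := by
  have := hμ.1
  have := hM.isProbabilityMeasure
  refine le_antisymm ?_ (hM.le_ksEntropy hμ)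
  rw [← hM.integral_log_p_codingMap hμ hcontr hδ hp hx hY]
  exact ksEntropy_le_neg_integral_log_p hM.isInvariantProb.2 hopen hcont hδ hp hx hY

theorem ksEntropy_add_energyIntegral
    (hM : 𝓜.IsGeneralizedMarkovMeasure μ M)
    (hμ : 𝓜.IsInvariant μ) (hcontr : 𝓜.IsContractive) (hopen : ∀ i, IsOpen (𝓜.vset i))
    (hcont : ∀ e, ContinuousOn (𝓜.p e) (𝓜.vset (𝓜.init e))) (hδ : 0 < δ)
    (hp : ∀ e, ∀ y ∈ 𝓜.vset (𝓜.init e), δ ≤ 𝓜.p e y) (hx : ∀ i, x i ∈ 𝓜.vset i)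
    (hY : ∀ᵐ σ ∂M, σ ∈ 𝓜.codingDomain x) :
    ksEntropy M leftShift + energyIntegral M (𝓜.energy x) = 0 := by
  have := hμ.1
  have := hM.isProbabilityMeasure
  rw [hM.ksEntropy_eq hμ hcontr hopen hcont hδ hp hx hY, energyIntegral_energy hδ hp hY,
    hM.integral_log_p_codingMap hμ hcontr hδ hp hx hY, ← EReal.coe_add, neg_add_cancel,
    EReal.coe_zero]

end IsGeneralizedMarkovMeasure

end Equilibrium

end MarkovSystem

end

theorem theorem2_general {K V E : Type*} [MetricSpace K] [PolishSpace K] [MeasurableSpace K]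
    [BorelSpace K] [Fintype E] [MeasurableSpace E] [DiscreteMeasurableSpace E]
    (𝓜 : MarkovSystem K V E)
    (hcontr : 𝓜.IsContractive)
    (hopen : ∀ i, IsOpen (𝓜.vset i))
    (hcont : ∀ e, ContinuousOn (𝓜.p e) (𝓜.vset (𝓜.init e)))
    (hpos : ∃ δ : ℝ, 0 < δ ∧ ∀ e, ∀ y ∈ 𝓜.vset (𝓜.init e), δ ≤ 𝓜.p e y)
    (x : V → K) (hx : ∀ i, x i ∈ 𝓜.vset i)
    (μ : Measure K) (hμ : 𝓜.IsInvariant μ)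
    (huniq : ∀ ν : Measure K, 𝓜.IsInvariant ν → ν = μ)
    (hY : 𝓜.generalizedMarkovMeasure hμ (𝓜.codingDomain x) = 1) :
    (IsEnergyFunction (𝓜.energy x) ∧
      IsEquilibriumState leftShift (𝓜.energy x) (𝓜.generalizedMarkovMeasure hμ) ∧
      ∀ Λ : Measure (ℤ → E), IsEquilibriumState leftShift (𝓜.energy x) Λ →
        Λ = 𝓜.generalizedMarkovMeasure hμ) ∧
    (𝓜.generalizedMarkovMeasure hμ).map (𝓜.codingMap x) = μ ∧
    ksEntropy (𝓜.generalizedMarkovMeasure hμ) (leftShift : (ℤ → E) → (ℤ → E)) =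
      ((-∑ e, ∫ y in 𝓜.vset (𝓜.init e), 𝓜.p e y * Real.log (𝓜.p e y) ∂μ : ℝ) : EReal) := by
  obtain ⟨δ, hδ, hp⟩ := hpos
  have hM := 𝓜.generalizedMarkovMeasure_spec hμ
  have := hμ.1
  have hinv := hM.isInvariantProb
  have := hinv.1
  have hYae := (mem_ae_iff_prob_eq_one (MarkovSystem.measurableSet_codingDomain x)).2 hY
  have hzero := hM.ksEntropy_add_energyIntegral hμ hcontr hopen hcont hδ hp hx hYae
  have hpressure : pressure leftShift (𝓜.energy x) = 0 :=
    le_antisymm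
      (iSup₂_le fun Θ hΘ =>
        MarkovSystem.ksEntropy_add_energyIntegral_nonpos hΘ hopen hcont hδ hp hx)
      (hzero.ge.trans (le_iSup₂_of_le _ hinv le_rfl))
  refine ⟨⟨MarkovSystem.isEnergyFunction_energy x, ⟨hinv, hzero.trans hpressure.symm⟩,
    fun Λ hΛ => hM.eq_of_zero_le_ksEntropy_add_energyIntegral huniq hcontr hopen hcont hδ hp hx
      hΛ.1 (hΛ.2.trans hpressure).ge⟩, hM.map_codingMap hμ hcontr hx hYae, ?_⟩
  have hset (e : E) : ∫ y in 𝓜.vset (𝓜.init e), 𝓜.p e y * Real.log (𝓜.p e y) ∂μ =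
      ∫ y, 𝓜.p e y * Real.log (𝓜.p e y) ∂μ :=
    setIntegral_eq_integral_of_forall_compl_eq_zero fun y hy => by rw [𝓜.p_zero e y hy, zero_mul]
  simp only [hset]
  exact hM.ksEntropy_eq hμ hcontr hopen hcont hδ hp hx hYae

theorem theorem2 {K V E : Type*} [MetricSpace K] [ProperSpace K] [MeasurableSpace K] [BorelSpace K]
    [Finite V] [Fintype E] [MeasurableSpace E] [DiscreteMeasurableSpace E]
    (𝓜 : MarkovSystem K V E)
    (hcontr : 𝓜.IsContractive)
    (hopen : ∀ i, IsOpen (𝓜.vset i))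
    (hcont : ∀ e, UniformContinuousOn (𝓜.p e) (𝓜.vset (𝓜.init e)))
    (hpos : ∃ δ : ℝ, 0 < δ ∧ ∀ e, ∀ y ∈ 𝓜.vset (𝓜.init e), δ ≤ 𝓜.p e y)
    (x : V → K) (hx : ∀ i, x i ∈ 𝓜.vset i)
    (μ : Measure K) (hμ : 𝓜.IsInvariant μ)
    (huniq : ∀ ν : Measure K, 𝓜.IsInvariant ν → ν = μ)
    (hY : 𝓜.generalizedMarkovMeasure hμ (𝓜.codingDomain x) = 1) :
    -- `u` is an energy function and `M` is its unique equilibrium state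
    (IsEnergyFunction (𝓜.energy x) ∧
      IsEquilibriumState leftShift (𝓜.energy x) (𝓜.generalizedMarkovMeasure hμ) ∧
      ∀ Λ : Measure (ℤ → E), IsEquilibriumState leftShift (𝓜.energy x) Λ →
        Λ = 𝓜.generalizedMarkovMeasure hμ) ∧
    -- `F(M) = μ`
    (𝓜.generalizedMarkovMeasure hμ).map (𝓜.codingMap x) = μ ∧
    -- the entropy formula
    ksEntropy (𝓜.generalizedMarkovMeasure hμ) (leftShift : (ℤ → E) → (ℤ → E)) =
      ((-∑ e, ∫ y in 𝓜.vset (𝓜.init e), 𝓜.p e y * Real.log (𝓜.p e y) ∂μ : ℝ) : EReal) :=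
  theorem2_general 𝓜 hcontr hopen (fun e => (hcont e).continuousOn) hpos x hx μ hμ huniq hY
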